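/- **Setting.** Let $N\ge 2$, $d\ge 0$, $A\in\mathbb R^{n\times n}$, $B\in\mathbb R^{n\times m}$, $p\in(0,1)$, $\mu=1-p$, $\sigma^2=p(1-p)$. Consider the $N$ agents $$x_i(k+1)=Ax_i(k)+\gamma(k)Bu_i(k-d),\qquad k\ge 0,\ i=1,\dots,N,$$ where $(\gamma(k))_{k\ge0}$ are i.i.d. Bernoulli variables with $P(\gamma(k)=0)=p$, $P(\gamma(k)=1)=1-p$, with deterministic initial values $x_i(0),u_i(-1),\dots,u_i(-d)$. The agents communicate over an undirected graph with symmetric nonnegative weighted adjacency matrix $(a_{ij})$ ($i$ and $j$ are neighbours iff $a_{ij}>0$). Let $L_G$ be its Laplacian, with eigenvalues $0=\lambda_1\le\lambda_2\le\dots\le\lambda_N$. The predictor-like protocol with gain $K\in\mathbb R^{m\times n}$ is, for $k\ge d$, $$u_i(k-d)=K\sum_{j}a_{ij}\big[\hat x_j(k|k-d)-\hat x_i(k|k-d)\big],\qquad \hat x_i(k|k-d)=A^dx_i(k-d)+\mu\sum_{j=1}^{d}A^{j-1}Bu_i(k-d-j).$$ The system is mean-square consensusable under this protocol if for all initial values there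 is a gain $K$ such that $\lim_{k\to\infty}E\|x_j(k)-x_i(k)\|^2=0$ for all $i,j$. For $Q>0$, $R>0$ and a real parameter $\gamma$, the parameterized algebraic Riccati equation (PARE) with parameter $\gamma$ is $$P=A'PA+Q-\gamma A'PB\big[R+B'PB+B'(A')^dPA^dB\big]^{-1}B'PA,$$ and its critical value is $\gamma_c=\inf\{\gamma\in[0,1]:\text{the PARE with parameter }\gamma\text{ has a solution }P>0\}$. **Theorem.** Assume that all eigenvalues of $A$ lie on or outside the unit circle; that $B$ has full column rank; that $(A,B,0,A^dB)$ is mean-square stabilizable, i.e. there is a constant $K$ such that $x(k+1)=Ax(k)+Bu(k)+\nu(k)A^dBu(k)$ with $u(k)=Kx(k)$, where $\nu$ is white noise (independent, mean zero, unit variance), satisfies $\lim_{k\to\infty} E\|x(k)\|^2=0$ for every initial state; and that the graph is connected. Let $Q>0$, $R>0$. If $$\gamma_2:=\frac{\mu^2}{\mu^2+\sigma^2}\cdot\frac{4\lambda_2\lambda_N}{(\lambda_2+\lambda_N)^2}>\gamma_c,$$ then the multi-agent system is mean-square consensusable under the predictor-like protocol. Moreover, the PARE with parameter $\gamma_2$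 has a solution $P>0$, and for every such $P$ the gain $$K=\frac{2\mu}{\lambda_2+\lambda_N}\big[\mu^2B'PB+\sigma^2B'(A')^dPA^dB\big]^{-1}B'PA$$ achieves mean-square consensus from all initial values. -/

import Mathlib

open MeasureTheory ProbabilityTheory Filter Topology Matrix

/-- Squared Euclidean norm of a vector of `ℝⁿ`. -/
noncomputable def sqNorm {n : ℕ} (v : Fin n → ℝ) : ℝ :=
  ‖(WithLp.toLp 2 v : EuclideanSpace ℝ (Fin n))‖ ^ 2

/-- An undirected graph on `N` agents, given by its symmetric, nonnegative weighted adjacency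
matrix; `i` and `j` are neighbours when `0 < weight i j`. -/
structure WeightedGraph (N : ℕ) where
  weight : Matrix (Fin N) (Fin N) ℝ
  symm : weight.IsSymm
  nonneg : ∀ i j, 0 ≤ weight i j

namespace WeightedGraph

variable {N : ℕ}

/-- The underlying simple graph (loops, which do not affect the Laplacian, are discarded). -/
def toSimpleGraph (G : WeightedGraph N) : SimpleGraph (Fin N) :=
  SimpleGraph.fromRel (fun i j => 0 < G.weight i j)

/-- The Laplacian: the diagonal matrix of degrees (row sums) minus the adjacency matrix. -/
def laplacian (G : WeightedGraph N) : Matrix (Fin N) (Fin N) ℝ :=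
  Matrix.diagonal (fun i => ∑ j, G.weight i j) - G.weight

theorem laplacian_isHermitian (G : WeightedGraph N) : G.laplacian.IsHermitian := by
  have h : G.weightᵀ = G.weight := G.symm
  simp [laplacian, Matrix.IsHermitian, Matrix.conjTranspose_eq_transpose_of_trivial, h]

/-- The eigenvalues of the Laplacian, with multiplicity, in ascending order
(Mathlib's `eigenvalues₀` is in descending order); index `0` is the smallest one. -/
noncomputable def lapEigenvalue (G : WeightedGraph N) (i : Fin N) : ℝ :=
  G.laplacian_isHermitian.eigenvalues₀ (Fin.cast (Fintype.card_fin N).symm i.rev)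

/-- The second smallest Laplacian eigenvalue. -/
noncomputable def lamTwo (G : WeightedGraph N) (hN : 2 ≤ N) : ℝ :=
  G.lapEigenvalue ⟨1, by omega⟩

/-- The largest Laplacian eigenvalue. -/
noncomputable def lamMax (G : WeightedGraph N) (hN : 2 ≤ N) : ℝ :=
  G.lapEigenvalue ⟨N - 1, by omega⟩

end WeightedGraph

/-- White noise: independent square-integrable random variables with mean zero and variance one. -/
structure IsWhiteNoise {Ω : Type*} [MeasurableSpace Ω] (Pr : Measure Ω) (ν : ℕ → Ω → ℝ) :
    Prop where
  memLp : ∀ k, MemLp (ν k) 2 Pr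
  indep : iIndepFun ν Pr
  mean : ∀ k, ∫ ω, ν k ω ∂Pr = 0
  variance : ∀ k, ∫ ω, (ν k ω) ^ 2 ∂Pr = 1

/-- The i.i.d. Bernoulli packet process: at every time the packet is lost (value `0`) with
probability `p` and delivered (value `1`) with probability `1 - p`. -/
structure IsPacketProcess {Ω : Type*} [MeasurableSpace Ω] (Pr : Measure Ω) (p : ℝ)
    (g : ℕ → Ω → ℝ) : Prop where
  measurable : ∀ k, Measurable (g k)
  indep : iIndepFun g Pr
  prob_zero : ∀ k, Pr {ω | g k ω = 0} = ENNReal.ofReal p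
  prob_one : ∀ k, Pr {ω | g k ω = 1} = ENNReal.ofReal (1 - p)

/-- Path of `x (k+1) = A x k + B u k + ν k (A₀ x k + B₀ u k)` with `u k = K x k`, for a given
realization `ν` of the noise. -/
def noisePath {n m : ℕ} (A : Matrix (Fin n) (Fin n) ℝ) (B : Matrix (Fin n) (Fin m) ℝ)
    (A₀ : Matrix (Fin n) (Fin n) ℝ) (B₀ : Matrix (Fin n) (Fin m) ℝ)
    (K : Matrix (Fin m) (Fin n) ℝ) (ν : ℕ → ℝ) (x₀ : Fin n → ℝ) : ℕ → Fin n → ℝ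
  | 0 => x₀
  | k + 1 =>
    let x := noisePath A B A₀ B₀ K ν x₀ k
    let u := K *ᵥ x
    A *ᵥ x + B *ᵥ u + ν k • (A₀ *ᵥ x + B₀ *ᵥ u)

/-- `(A, B, A₀, B₀)` is mean-square stabilizable: some constant state feedback drives the second
moment of the state, driven by the noise `ν`, to zero from every initial state. -/
def MeanSquareStabilizable {Ω : Type*} [MeasurableSpace Ω] (Pr : Measure Ω) (ν : ℕ → Ω → ℝ)
    {n m : ℕ} (A : Matrix (Fin n) (Fin n) ℝ) (B : Matrix (Fin n) (Fin m) ℝ)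
    (A₀ : Matrix (Fin n) (Fin n) ℝ) (B₀ : Matrix (Fin n) (Fin m) ℝ) : Prop :=
  ∃ K : Matrix (Fin m) (Fin n) ℝ, ∀ x₀ : Fin n → ℝ,
    Tendsto (fun k => ∫ ω, sqNorm (noisePath A B A₀ B₀ K (fun t => ν t ω) x₀ k) ∂Pr)
      atTop (𝓝 0)

/-- What is known at time `k`: the agents' states `x i = x_i(k)` and their last `d` inputs,
`past j i = u_i(k - 1 - j)`. -/
structure LoopState (N n m d : ℕ) where
  x : Fin N → Fin n → ℝ
  past : Fin d → Fin N → Fin m → ℝ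

namespace LoopState

variable {N n m d : ℕ}

/-- The predictor at time `k` of the state of agent `i` at time `k + d`:
`A^d x_i(k) + (1 - p) ∑_{j=1}^{d} A^{j-1} B u_i(k - j)`. -/
def predictor (A : Matrix (Fin n) (Fin n) ℝ) (B : Matrix (Fin n) (Fin m) ℝ) (p : ℝ)
    (s : LoopState N n m d) (i : Fin N) : Fin n → ℝ :=
  (A ^ d) *ᵥ s.x i + (1 - p) • ∑ j : Fin d, (A ^ (j : ℕ) * B) *ᵥ s.past j i

/-- The predictor-like protocol: `u_i(k)` is `K` applied to the weighted sum over the neighbours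
of `i` of the relative predictors. -/
def protocol (A : Matrix (Fin n) (Fin n) ℝ) (B : Matrix (Fin n) (Fin m) ℝ) (p : ℝ)
    (G : WeightedGraph N) (K : Matrix (Fin m) (Fin n) ℝ)
    (s : LoopState N n m d) (i : Fin N) : Fin m → ℝ :=
  K *ᵥ ∑ j, G.weight i j • (s.predictor A B p j - s.predictor A B p i)

/-- The inputs `u(k), u(k - 1), …, u(k - d)`. -/
def inputs (A : Matrix (Fin n) (Fin n) ℝ) (B : Matrix (Fin n) (Fin m) ℝ) (p : ℝ)
    (G : WeightedGraph N) (K : Matrix (Fin m) (Fin n) ℝ)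
    (s : LoopState N n m d) : Fin (d + 1) → Fin N → Fin m → ℝ :=
  Matrix.vecCons (s.protocol A B p G K) s.past

end LoopState

/-- The closed loop `x_i(k+1) = A x_i(k) + γ(k) B u_i(k-d)` under the predictor-like protocol, for
a given realization `g` of the packet process. The initial values are `x_i(0) = x₀ i` and
`u_i(-1-j) = u₀ j i` for `j = 0, …, d - 1`. -/
def closedLoop {N n m d : ℕ} (A : Matrix (Fin n) (Fin n) ℝ) (B : Matrix (Fin n) (Fin m) ℝ)
    (p : ℝ) (G : WeightedGraph N) (K : Matrix (Fin m) (Fin n) ℝ) (g : ℕ → ℝ)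
    (x₀ : Fin N → Fin n → ℝ) (u₀ : Fin d → Fin N → Fin m → ℝ) : ℕ → LoopState N n m d
  | 0 => ⟨x₀, u₀⟩
  | k + 1 =>
    let s := closedLoop A B p G K g x₀ u₀ k
    let v := s.inputs A B p G K
    { x := fun i => A *ᵥ s.x i + g k • (B *ᵥ v (Fin.last d) i)
      past := fun j => v j.castSucc }

/-- With gain `K` the protocol enforces mean-square consensus from the given initial values. -/
def EnforcesConsensus {Ω : Type*} [MeasurableSpace Ω] (Pr : Measure Ω) (g : ℕ → Ω → ℝ)
    {N n m d : ℕ} (A : Matrix (Fin n) (Fin n) ℝ) (B : Matrix (Fin n) (Fin m) ℝ)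
    (p : ℝ) (G : WeightedGraph N) (K : Matrix (Fin m) (Fin n) ℝ)
    (x₀ : Fin N → Fin n → ℝ) (u₀ : Fin d → Fin N → Fin m → ℝ) : Prop :=
  ∀ i j : Fin N,
    Tendsto (fun k => ∫ ω, sqNorm ((closedLoop A B p G K (fun t => g t ω) x₀ u₀ k).x j
      - (closedLoop A B p G K (fun t => g t ω) x₀ u₀ k).x i) ∂Pr) atTop (𝓝 0)

/-- Mean-square consensusability under the predictor-like protocol with input delay `d`. -/
def MeanSquareConsensusable {Ω : Type*} [MeasurableSpace Ω] (Pr : Measure Ω) (g : ℕ → Ω → ℝ)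
    {N n m : ℕ} (d : ℕ) (A : Matrix (Fin n) (Fin n) ℝ) (B : Matrix (Fin n) (Fin m) ℝ)
    (p : ℝ) (G : WeightedGraph N) : Prop :=
  ∀ (x₀ : Fin N → Fin n → ℝ) (u₀ : Fin d → Fin N → Fin m → ℝ),
    ∃ K : Matrix (Fin m) (Fin n) ℝ, EnforcesConsensus Pr g A B p G K x₀ u₀

/-- The right-hand side of the parameterized algebraic Riccati equation. -/
noncomputable def pareMap {n m : ℕ} (d : ℕ) (A : Matrix (Fin n) (Fin n) ℝ)
    (B : Matrix (Fin n) (Fin m) ℝ) (Q : Matrix (Fin n) (Fin n) ℝ) (R : Matrix (Fin m) (Fin m) ℝ)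
    (c : ℝ) (P : Matrix (Fin n) (Fin n) ℝ) : Matrix (Fin n) (Fin n) ℝ :=
  Aᵀ * P * A + Q
    - c • (Aᵀ * P * B * (R + Bᵀ * P * B + Bᵀ * Aᵀ ^ d * P * A ^ d * B)⁻¹ * Bᵀ * P * A)

/-- `P` is a positive definite solution of the PARE with parameter `c`. -/
def IsPareSolution {n m : ℕ} (d : ℕ) (A : Matrix (Fin n) (Fin n) ℝ)
    (B : Matrix (Fin n) (Fin m) ℝ) (Q : Matrix (Fin n) (Fin n) ℝ) (R : Matrix (Fin m) (Fin m) ℝ)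
    (c : ℝ) (P : Matrix (Fin n) (Fin n) ℝ) : Prop :=
  P.PosDef ∧ P = pareMap d A B Q R c P

/-- The critical value: the infimum of the parameters in `[0, 1]` for which the PARE has a
positive definite solution. -/
noncomputable def criticalValue {n m : ℕ} (d : ℕ) (A : Matrix (Fin n) (Fin n) ℝ)
    (B : Matrix (Fin n) (Fin m) ℝ) (Q : Matrix (Fin n) (Fin n) ℝ)
    (R : Matrix (Fin m) (Fin m) ℝ) : ℝ :=
  sInf {c : ℝ | c ∈ Set.Icc (0 : ℝ) 1 ∧ ∃ P, IsPareSolution d A B Q R c P}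

/-- `μ²/(μ²+σ²) · 4 λ₂ λ_N / (λ₂ + λ_N)²` with `μ = 1 - p` and `σ² = p (1 - p)`. -/
noncomputable def gammaTwo {N : ℕ} (p : ℝ) (G : WeightedGraph N) (hN : 2 ≤ N) : ℝ :=
  (1 - p) ^ 2 / ((1 - p) ^ 2 + p * (1 - p))
    * (4 * G.lamTwo hN * G.lamMax hN / (G.lamTwo hN + G.lamMax hN) ^ 2)

/-- The explicit gain
`2μ/(λ₂+λ_N) · [μ² B'PB + σ² B'(A')^d P A^d B]⁻¹ B'PA` built from a matrix `P`. -/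
noncomputable def consensusGain {N n m : ℕ} (d : ℕ) (A : Matrix (Fin n) (Fin n) ℝ)
    (B : Matrix (Fin n) (Fin m) ℝ) (p : ℝ) (G : WeightedGraph N) (hN : 2 ≤ N)
    (P : Matrix (Fin n) (Fin n) ℝ) : Matrix (Fin m) (Fin n) ℝ :=
  (2 * (1 - p) / (G.lamTwo hN + G.lamMax hN)) •
    (((1 - p) ^ 2 • (Bᵀ * P * B) + (p * (1 - p)) • (Bᵀ * Aᵀ ^ d * P * A ^ d * B))⁻¹
      * Bᵀ * P * A)

/-!
The predictor removes the delay. Along an eigenvector `v` of the Laplacian with eigenvalue `l`, the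
component `z` of the predictors satisfies
`z(k+1) = (A - μ l B K) z(k) + (γ(k) - μ) A^d B u(k-d)`, where `u = -l K z`
(`modePredictor_closedLoop_succ`): the delayed input is multiplied by centered noise that is
independent of the past. Hence `E z'Pz` plus `σ²` times the moments `E ‖A^d B u‖²_P` of the last `d`
inputs decreases by at least `E z'Qz` per step as soon as
`(A - μ l B K)'P(A - μ l B K) + σ² l² K'B'(A')^d P A^d B K ≤ P - Q`.
For the given gain and `l ∈ [λ₂, λ_N]` this follows from the PARE with parameter `γ₂` by completing
the square (`lyapunov_inequality`). So `z → 0` in mean square, then the inputs tend to zero, then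
`A^d x`, and finally `x`, since `A` has no eigenvalue `0` (`entriesIn_msNull_modeState`). As
`γ₂ > γ_c ≥ 0` forces `λ₂ > 0`, an eigenvector whose eigenvalue is not in `[λ₂, λ_N]` is constant,
and the differences `x_j - x_i` have no component along it.

For the solvability of the PARE, the form of the Riccati map at `P` is a minimum over inputs of
quantities increasing in `P` (`quad_pareMap_mono`), so that value iteration from `0` converges to a
solution whenever some positive semidefinite `X` lies above its image
(`exists_isPareSolution_of_supersolution`). A solution for a smaller parameter is such an `X`. For
the parameter `1`, mean-square stabilizability gives one: if `T` is the second-moment map of the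
stabilized system, then `T^k 1 → 0`, and a multiple of a finite sum `∑ T^j 1` works
(`exists_isPareSolution_one`). This makes the set defining `γ_c` nonempty.
-/

/-! ### Quadratic forms of real matrices -/

/-- The quadratic form `x ↦ xᵀ M x` of a square real matrix. -/
def quad {ι : Type*} [Fintype ι] (M : Matrix ι ι ℝ) (x : ι → ℝ) : ℝ := x ⬝ᵥ M *ᵥ x

section Quad

variable {ι κ : Type*} [Fintype ι] [Fintype κ]

theorem quad_add (M M' : Matrix ι ι ℝ) (x : ι → ℝ) :
    quad (M + M') x = quad M x + quad M' x := by
  simp [quad, add_mulVec]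

theorem quad_sub (M M' : Matrix ι ι ℝ) (x : ι → ℝ) :
    quad (M - M') x = quad M x - quad M' x := by
  simp [quad, sub_mulVec]

theorem quad_smul (c : ℝ) (M : Matrix ι ι ℝ) (x : ι → ℝ) : quad (c • M) x = c * quad M x := by
  simp [quad, smul_mulVec]

theorem quad_zero (x : ι → ℝ) : quad (0 : Matrix ι ι ℝ) x = 0 := by simp [quad]

theorem quad_conj (M : Matrix ι ι ℝ) (F : Matrix ι κ ℝ) (x : κ → ℝ) :
    quad (Fᵀ * M * F) x = quad M (F *ᵥ x) := by
  simp only [quad, ← mulVec_mulVec, dotProduct_mulVec, vecMul_transpose]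

theorem dotProduct_mulVec_comm_of_isHermitian {M : Matrix ι ι ℝ} (hM : M.IsHermitian)
    (x y : ι → ℝ) : y ⬝ᵥ M *ᵥ x = x ⬝ᵥ M *ᵥ y := by
  have h : Mᵀ = M := by simpa [IsHermitian, conjTranspose_eq_transpose_of_trivial] using hM
  rw [dotProduct_comm, dotProduct_mulVec, ← mulVec_transpose, h, dotProduct_comm,
    dotProduct_comm]

theorem quad_add_vec {M : Matrix ι ι ℝ} (hM : M.IsHermitian) (x y : ι → ℝ) :
    quad M (x + y) = quad M x + 2 * (y ⬝ᵥ M *ᵥ x) + quad M y := by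
  simp only [quad, mulVec_add, add_dotProduct, dotProduct_add]
  rw [dotProduct_mulVec_comm_of_isHermitian hM x y]
  ring

theorem quad_smul_vec (M : Matrix ι ι ℝ) (c : ℝ) (x : ι → ℝ) :
    quad M (c • x) = c ^ 2 * quad M x := by
  simp only [quad, mulVec_smul, smul_dotProduct, dotProduct_smul, smul_eq_mul]
  ring

theorem quad_nonneg {M : Matrix ι ι ℝ} (hM : M.PosSemidef) (x : ι → ℝ) : 0 ≤ quad M x := by
  simpa [quad] using hM.dotProduct_mulVec_nonneg x

theorem quad_pos {M : Matrix ι ι ℝ} (hM : M.PosDef) {x : ι → ℝ} (hx : x ≠ 0) : 0 < quad M x := by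
  simpa [quad] using hM.dotProduct_mulVec_pos hx

theorem quad_one [DecidableEq ι] (x : ι → ℝ) : quad (1 : Matrix ι ι ℝ) x = ∑ i, x i ^ 2 := by
  simp [quad, dotProduct, sq]

theorem posSemidef_of_quad {M : Matrix ι ι ℝ} (hM : M.IsHermitian) (h : ∀ x, 0 ≤ quad M x) :
    M.PosSemidef :=
  PosSemidef.of_dotProduct_mulVec_nonneg hM (by simpa [quad] using h)

theorem posDef_of_quad {M : Matrix ι ι ℝ} (hM : M.IsHermitian)
    (h : ∀ x, x ≠ 0 → 0 < quad M x) : M.PosDef :=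
  PosDef.of_dotProduct_mulVec_pos hM (by simpa [quad] using h)

/-- The forms of a matrix are bounded by a multiple of the squared Euclidean norm. -/
theorem quad_le_sum_abs_mul (M : Matrix ι ι ℝ) (x : ι → ℝ) :
    quad M x ≤ (∑ i, ∑ j, |M i j|) * ∑ i, x i ^ 2 := by
  have key : ∀ i j, x i * (M i j * x j) ≤ |M i j| * ∑ l, x l ^ 2 := by
    intro i j
    have hi : x i ^ 2 ≤ ∑ l, x l ^ 2 :=
      Finset.single_le_sum (f := fun l => x l ^ 2) (fun l _ => sq_nonneg _) (Finset.mem_univ i)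
    have hj : x j ^ 2 ≤ ∑ l, x l ^ 2 :=
      Finset.single_le_sum (f := fun l => x l ^ 2) (fun l _ => sq_nonneg _) (Finset.mem_univ j)
    have h1 : |x i * x j| ≤ ∑ l, x l ^ 2 := by
      rw [abs_le]
      constructor <;> nlinarith [sq_nonneg (x i + x j), sq_nonneg (x i - x j)]
    calc x i * (M i j * x j) ≤ |x i * (M i j * x j)| := le_abs_self _
      _ = |M i j| * |x i * x j| := by rw [← abs_mul]; congr 1; ring
      _ ≤ _ := mul_le_mul_of_nonneg_left h1 (abs_nonneg _)
  calc quad M x = ∑ i, ∑ j, x i * (M i j * x j) := by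
        simp only [quad, dotProduct, mulVec, Finset.mul_sum]
    _ ≤ ∑ i, ∑ j, |M i j| * ∑ l, x l ^ 2 :=
        Finset.sum_le_sum fun i _ => Finset.sum_le_sum fun j _ => key i j
    _ = _ := by simp only [Finset.sum_mul]

/-- Polarization: a symmetric matrix is determined by its quadratic form. -/
theorem apply_eq_quad [DecidableEq ι] {M : Matrix ι ι ℝ} (hM : M.IsHermitian) (i j : ι) :
    M i j = (quad M (Pi.single i 1 + Pi.single j 1) - quad M (Pi.single i 1)
      - quad M (Pi.single j 1)) / 2 := by
  rw [add_comm (Pi.single i 1), quad_add_vec hM]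
  simp [quad]

/-- Symmetric matrices converge as soon as their quadratic forms converge pointwise. -/
theorem exists_tendsto_of_tendsto_quad [DecidableEq ι] {M : ℕ → Matrix ι ι ℝ}
    (hM : ∀ k, (M k).IsHermitian) {q : (ι → ℝ) → ℝ}
    (h : ∀ x, Tendsto (fun k => quad (M k) x) atTop (𝓝 (q x))) :
    ∃ M', Tendsto M atTop (𝓝 M') ∧ M'.IsHermitian ∧ ∀ x, quad M' x = q x := by
  set M' : Matrix ι ι ℝ := Matrix.of fun i j =>
    (q (Pi.single i 1 + Pi.single j 1) - q (Pi.single i 1) - q (Pi.single j 1)) / 2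
  have ht : Tendsto M atTop (𝓝 M') := by
    refine tendsto_pi_nhds.2 fun i => tendsto_pi_nhds.2 fun j => ?_
    simp only [fun k => apply_eq_quad (hM k) i j]
    exact (((h _).sub (h _)).sub (h _)).div_const 2
  refine ⟨M', ht, ?_, fun x => ?_⟩
  · ext i j
    simp only [M', conjTranspose_apply, of_apply, star_trivial]
    rw [add_comm (Pi.single j 1)]
    ring
  · refine tendsto_nhds_unique ?_ (h x)
    have hc : Continuous fun N : Matrix ι ι ℝ => quad N x := by
      unfold quad
      fun_prop
    exact (hc.tendsto M').comp ht

/-- Completing the square for a positive definite matrix. -/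
theorem quad_add_inv_mulVec [DecidableEq ι] {W : Matrix ι ι ℝ} (hW : W.PosDef) (u y : ι → ℝ) :
    quad W (W⁻¹ *ᵥ y + u) = quad W⁻¹ y + 2 * (u ⬝ᵥ y) + quad W u := by
  have hu : IsUnit W.det := (isUnit_iff_isUnit_det W).1 hW.isUnit
  have h : W *ᵥ (W⁻¹ *ᵥ y) = y := by rw [mulVec_mulVec, mul_nonsing_inv _ hu, one_mulVec]
  rw [quad_add_vec hW.isHermitian, h]
  simp only [quad, h]
  rw [dotProduct_comm (W⁻¹ *ᵥ y)]

theorem neg_quad_inv_le [DecidableEq ι] {W : Matrix ι ι ℝ} (hW : W.PosDef) (u y : ι → ℝ) :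
    -quad W⁻¹ y ≤ 2 * (u ⬝ᵥ y) + quad W u := by
  have := quad_nonneg hW.posSemidef (W⁻¹ *ᵥ y + u)
  rw [quad_add_inv_mulVec hW] at this
  linarith

/-- The linear and the quadratic part of `u ↦ 2 u·y + u'Wu` along the line through its
minimizer. -/
theorem forms_smul_inv_mulVec [DecidableEq ι] {W : Matrix ι ι ℝ} (hW : W.PosDef) (y : ι → ℝ)
    (t : ℝ) :
    (t • W⁻¹ *ᵥ y) ⬝ᵥ y = t * quad W⁻¹ y ∧ quad W (t • W⁻¹ *ᵥ y) = t ^ 2 * quad W⁻¹ y := by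
  have hu : IsUnit W.det := (isUnit_iff_isUnit_det W).1 hW.isUnit
  have h : W *ᵥ (W⁻¹ *ᵥ y) = y := by rw [mulVec_mulVec, mul_nonsing_inv _ hu, one_mulVec]
  constructor
  · rw [smul_dotProduct, smul_eq_mul, dotProduct_comm, quad]
  · rw [quad_smul_vec, quad, h, dotProduct_comm, quad]

theorem neg_quad_inv_eq [DecidableEq ι] {W : Matrix ι ι ℝ} (hW : W.PosDef) (y : ι → ℝ) :
    -quad W⁻¹ y = 2 * (((-1 : ℝ) • W⁻¹ *ᵥ y) ⬝ᵥ y) + quad W ((-1 : ℝ) • W⁻¹ *ᵥ y) := by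
  rw [(forms_smul_inv_mulVec hW y _).1, (forms_smul_inv_mulVec hW y _).2]
  ring

/-- Inversion of positive definite matrices reverses the order, in the form in which the two
matrices are compared up to a positive scalar. -/
theorem quad_inv_le_mul_quad_inv [DecidableEq ι] {W W' : Matrix ι ι ℝ} (hW : W.PosDef)
    (hW' : W'.PosDef) {s : ℝ} (hs : 0 < s) (h : ∀ u, quad W' u ≤ s * quad W u) (y : ι → ℝ) :
    quad W⁻¹ y ≤ s * quad W'⁻¹ y := by
  obtain ⟨h1, h2⟩ := forms_smul_inv_mulVec hW y (-s⁻¹)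
  have h3 := neg_quad_inv_le hW' ((-s⁻¹) • W⁻¹ *ᵥ y) y
  have h4 := h ((-s⁻¹) • W⁻¹ *ᵥ y)
  have h5 : s * ((-s⁻¹) ^ 2 * quad W⁻¹ y) = s⁻¹ * quad W⁻¹ y := by field_simp
  rw [h2, h5] at h4
  rw [h1] at h3
  calc quad W⁻¹ y = s * (s⁻¹ * quad W⁻¹ y) := by field_simp
    _ ≤ _ := mul_le_mul_of_nonneg_left (by linarith) hs.le

end Quad

/-! ### The parameterized Riccati equation -/

section Riccati

variable {n m : ℕ} {d : ℕ} {A : Matrix (Fin n) (Fin n) ℝ} {B : Matrix (Fin n) (Fin m) ℝ}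
  {Q : Matrix (Fin n) (Fin n) ℝ} {R : Matrix (Fin m) (Fin m) ℝ}

theorem quad_delayed_input (P : Matrix (Fin n) (Fin n) ℝ) (u : Fin m → ℝ) :
    quad (Bᵀ * Aᵀ ^ d * P * A ^ d * B) u = quad P ((A ^ d * B) *ᵥ u) := by
  rw [← quad_conj, transpose_mul, transpose_pow]
  simp only [Matrix.mul_assoc]

theorem posSemidef_conj {ι κ : Type*} [Fintype ι] [Fintype κ] {P : Matrix ι ι ℝ}
    (hP : P.PosSemidef) (F : Matrix ι κ ℝ) : (Fᵀ * P * F).PosSemidef := by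
  simpa [conjTranspose_eq_transpose_of_trivial] using hP.conjTranspose_mul_mul_same F

theorem posSemidef_delayed_input {P : Matrix (Fin n) (Fin n) ℝ} (hP : P.PosSemidef) :
    (Bᵀ * Aᵀ ^ d * P * A ^ d * B).PosSemidef := by
  have := posSemidef_conj hP (A ^ d * B)
  rw [transpose_mul, transpose_pow] at this
  simpa only [Matrix.mul_assoc] using this

/-- The matrix `R + B'PB + B'(A')^d P A^d B` inverted in the PARE. -/
def inputWeight (d : ℕ) (A : Matrix (Fin n) (Fin n) ℝ) (B : Matrix (Fin n) (Fin m) ℝ)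
    (R : Matrix (Fin m) (Fin m) ℝ) (P : Matrix (Fin n) (Fin n) ℝ) : Matrix (Fin m) (Fin m) ℝ :=
  R + Bᵀ * P * B + Bᵀ * Aᵀ ^ d * P * A ^ d * B

theorem inputWeight_posDef (hR : R.PosDef) {P : Matrix (Fin n) (Fin n) ℝ} (hP : P.PosSemidef) :
    (inputWeight d A B R P).PosDef :=
  (hR.add_posSemidef (posSemidef_conj hP B)).add_posSemidef (posSemidef_delayed_input hP)

theorem quad_inputWeight (P : Matrix (Fin n) (Fin n) ℝ) (u : Fin m → ℝ) :
    quad (inputWeight d A B R P) u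
      = quad R u + quad P (B *ᵥ u) + quad P ((A ^ d * B) *ᵥ u) := by
  rw [inputWeight, quad_add, quad_add, quad_conj, quad_delayed_input]

theorem pareMap_eq {P : Matrix (Fin n) (Fin n) ℝ} (hP : P.IsHermitian) (c : ℝ) :
    pareMap d A B Q R c P = Aᵀ * P * A + Q
      - c • ((Bᵀ * P * A)ᵀ * (inputWeight d A B R P)⁻¹ * (Bᵀ * P * A)) := by
  have h : Pᵀ = P := by simpa [IsHermitian, conjTranspose_eq_transpose_of_trivial] using hP
  simp only [pareMap, inputWeight, transpose_mul, transpose_transpose, h, Matrix.mul_assoc]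

theorem quad_pareMap {P : Matrix (Fin n) (Fin n) ℝ} (hP : P.IsHermitian) (c : ℝ)
    (x : Fin n → ℝ) :
    quad (pareMap d A B Q R c P) x = quad P (A *ᵥ x) + quad Q x
      - c * quad (inputWeight d A B R P)⁻¹ ((Bᵀ * P * A) *ᵥ x) := by
  rw [pareMap_eq hP, quad_sub, quad_add, quad_smul, quad_conj, quad_conj]

theorem pareMap_isHermitian (hQ : Q.IsHermitian) (hR : R.PosDef)
    {P : Matrix (Fin n) (Fin n) ℝ} (hP : P.PosSemidef) (c : ℝ) :
    (pareMap d A B Q R c P).IsHermitian := by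
  rw [pareMap_eq hP.isHermitian]
  refine ((posSemidef_conj hP A).isHermitian.add hQ).sub ?_
  have := (posSemidef_conj (inputWeight_posDef (d := d) (A := A) (B := B) hR hP).inv.posSemidef
    (Bᵀ * P * A)).isHermitian
  rw [IsHermitian, conjTranspose_smul, this]
  simp

/-- The cost of applying the input `u` at the state `x`; its minimum over `u` is the form of the
Riccati map. -/
def stageCost (d : ℕ) (A : Matrix (Fin n) (Fin n) ℝ) (B : Matrix (Fin n) (Fin m) ℝ)
    (Q : Matrix (Fin n) (Fin n) ℝ) (R : Matrix (Fin m) (Fin m) ℝ) (c : ℝ)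
    (P : Matrix (Fin n) (Fin n) ℝ) (x : Fin n → ℝ) (u : Fin m → ℝ) : ℝ :=
  (1 - c) * quad P (A *ᵥ x) + quad Q x
    + c * (quad P (A *ᵥ x + B *ᵥ u) + quad P ((A ^ d * B) *ᵥ u) + quad R u)

theorem stageCost_eq {P : Matrix (Fin n) (Fin n) ℝ} (hP : P.IsHermitian) (c : ℝ)
    (x : Fin n → ℝ) (u : Fin m → ℝ) :
    stageCost d A B Q R c P x u = quad P (A *ᵥ x) + quad Q x
      + c * (2 * (u ⬝ᵥ (Bᵀ * P * A) *ᵥ x) + quad (inputWeight d A B R P) u) := by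
  have h : (B *ᵥ u) ⬝ᵥ P *ᵥ A *ᵥ x = u ⬝ᵥ (Bᵀ * P * A) *ᵥ x := by
    rw [← mulVec_mulVec, ← mulVec_mulVec, dotProduct_mulVec u, vecMul_transpose]
  rw [stageCost, quad_add_vec hP, quad_inputWeight, h]
  ring

theorem quad_pareMap_le_stageCost (hR : R.PosDef) {P : Matrix (Fin n) (Fin n) ℝ}
    (hP : P.PosSemidef) {c : ℝ} (hc : 0 ≤ c) (x : Fin n → ℝ) (u : Fin m → ℝ) :
    quad (pareMap d A B Q R c P) x ≤ stageCost d A B Q R c P x u := by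
  rw [stageCost_eq hP.isHermitian, quad_pareMap hP.isHermitian]
  nlinarith [mul_le_mul_of_nonneg_left
    (neg_quad_inv_le (inputWeight_posDef (d := d) (A := A) (B := B) hR hP) u
      ((Bᵀ * P * A) *ᵥ x)) hc]

theorem exists_quad_pareMap_eq_stageCost (hR : R.PosDef) {P : Matrix (Fin n) (Fin n) ℝ}
    (hP : P.PosSemidef) (c : ℝ) (x : Fin n → ℝ) :
    ∃ u, quad (pareMap d A B Q R c P) x = stageCost d A B Q R c P x u := by
  refine ⟨(-1 : ℝ) • (inputWeight d A B R P)⁻¹ *ᵥ ((Bᵀ * P * A) *ᵥ x), ?_⟩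
  rw [stageCost_eq hP.isHermitian, quad_pareMap hP.isHermitian,
    ← neg_quad_inv_eq (inputWeight_posDef hR hP)]
  ring

/-- The Riccati map is monotone, since it is a minimum of monotone maps. -/
theorem quad_pareMap_mono (hR : R.PosDef) {P P' : Matrix (Fin n) (Fin n) ℝ}
    (hP : P.PosSemidef) (hP' : P'.PosSemidef) (h : ∀ x, quad P x ≤ quad P' x) {c : ℝ}
    (hc : c ∈ Set.Icc (0 : ℝ) 1) (x : Fin n → ℝ) :
    quad (pareMap d A B Q R c P) x ≤ quad (pareMap d A B Q R c P') x := by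
  obtain ⟨u, hu⟩ := exists_quad_pareMap_eq_stageCost (d := d) (A := A) (B := B) (Q := Q) hR hP' c x
  rw [hu]
  refine (quad_pareMap_le_stageCost hR hP hc.1 x u).trans ?_
  unfold stageCost
  have h1 := mul_le_mul_of_nonneg_left (h (A *ᵥ x)) (sub_nonneg.2 hc.2)
  have h2 := mul_le_mul_of_nonneg_left
    (add_le_add (h (A *ᵥ x + B *ᵥ u)) (h ((A ^ d * B) *ᵥ u))) hc.1
  linarith

theorem pareMap_zero (c : ℝ) : pareMap d A B Q R c 0 = Q := by
  simp [pareMap]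

theorem continuousAt_pareMap (hR : R.PosDef) {P : Matrix (Fin n) (Fin n) ℝ} (hP : P.PosSemidef)
    (c : ℝ) : ContinuousAt (pareMap d A B Q R c) P := by
  have hdet : (inputWeight d A B R P).det ≠ 0 :=
    ((isUnit_iff_isUnit_det _).1 (inputWeight_posDef hR hP).isUnit).ne_zero
  have hinv : ContinuousAt (fun X => (inputWeight d A B R X)⁻¹) P := by
    have hW : ContinuousAt (fun X => inputWeight d A B R X) P := by
      unfold inputWeight
      fun_prop
    refine ContinuousAt.comp (f := fun X => inputWeight d A B R X) (g := fun W => W⁻¹) ?_ hW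
    refine continuousAt_matrix_inv _ ?_
    rw [Ring.inverse_eq_inv']
    exact continuousAt_inv₀ hdet
  have hcont : Continuous fun Z : Matrix (Fin n) (Fin n) ℝ × Matrix (Fin m) (Fin m) ℝ =>
      Aᵀ * Z.1 * A + Q - c • (Aᵀ * Z.1 * B * Z.2 * Bᵀ * Z.1 * A) := by
    fun_prop
  exact ContinuousAt.comp (f := fun X => (X, (inputWeight d A B R X)⁻¹)) hcont.continuousAt
    (continuousAt_id.prodMk hinv)

/-- Value iteration from `0` converges to a solution of the PARE as soon as some positive
semidefinite `X` lies above its image under the Riccati map. -/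
theorem exists_isPareSolution_of_supersolution (hQ : Q.PosDef) (hR : R.PosDef) {c : ℝ}
    (hc : c ∈ Set.Icc (0 : ℝ) 1) {X : Matrix (Fin n) (Fin n) ℝ} (hX : X.PosSemidef)
    (hle : ∀ x, quad (pareMap d A B Q R c X) x ≤ quad X x) :
    ∃ P, IsPareSolution d A B Q R c P := by
  set f := pareMap d A B Q R c with hf
  set S : ℕ → Matrix (Fin n) (Fin n) ℝ := fun k => f^[k] 0 with hS
  have hsucc : ∀ k, S (k + 1) = f (S k) := fun k => Function.iterate_succ_apply' f k 0
  have hinv : ∀ k, (S k).PosSemidef ∧ (∀ x, quad (S k) x ≤ quad X x)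
      ∧ ∀ x, quad (S k) x ≤ quad (S (k + 1)) x := by
    intro k
    induction k with
    | zero =>
      refine ⟨PosSemidef.zero, fun x => ?_, fun x => ?_⟩
      · simpa [hS, quad_zero] using quad_nonneg hX x
      · rw [hsucc]
        simpa [hS, hf, quad_zero, pareMap_zero] using quad_nonneg hQ.posSemidef x
    | succ k ih =>
      obtain ⟨h1, h2, h3⟩ := ih
      have hpsd : (S (k + 1)).PosSemidef := by
        refine posSemidef_of_quad ?_ fun x => (quad_nonneg h1 x).trans (h3 x)
        rw [hsucc]
        exact pareMap_isHermitian hQ.isHermitian hR h1 c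
      refine ⟨hpsd, fun x => ?_, fun x => ?_⟩
      · rw [hsucc]
        exact (quad_pareMap_mono hR h1 hX h2 hc x).trans (hle x)
      · rw [hsucc (k + 1)]
        nth_rewrite 1 [hsucc k]
        exact quad_pareMap_mono hR h1 hpsd h3 hc x
  have hmono : ∀ x, Monotone fun k => quad (S k) x :=
    fun x => monotone_nat_of_le_succ fun k => (hinv k).2.2 x
  have hlim : ∀ x, Tendsto (fun k => quad (S k) x) atTop (𝓝 (⨆ k, quad (S k) x)) := fun x =>
    tendsto_atTop_ciSup (hmono x) ⟨quad X x, by rintro _ ⟨k, rfl⟩; exact (hinv k).2.1 x⟩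
  obtain ⟨P, hP, hPh, hPq⟩ :=
    exists_tendsto_of_tendsto_quad (fun k => (hinv k).1.isHermitian) hlim
  have hQP : ∀ x, quad Q x ≤ quad P x := by
    intro x
    rw [hPq]
    have := (hmono x).ge_of_tendsto (hlim x) 1
    simpa [hS, hf, pareMap_zero] using this
  have hPpd : P.PosDef := posDef_of_quad hPh fun x hx => (quad_pos hQ hx).trans_le (hQP x)
  refine ⟨P, hPpd, tendsto_nhds_unique ((tendsto_add_atTop_iff_nat 1).2 hP) ?_⟩
  simp only [hsucc]
  exact (continuousAt_pareMap hR hPpd.posSemidef c).tendsto.comp hP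

/-- Solvability of the PARE persists when the parameter grows. -/
theorem exists_isPareSolution_of_le (hQ : Q.PosDef) (hR : R.PosDef) {c c' : ℝ} (hc : 0 ≤ c)
    (hcc' : c ≤ c') (hc' : c' ≤ 1) (h : ∃ P, IsPareSolution d A B Q R c P) :
    ∃ P, IsPareSolution d A B Q R c' P := by
  obtain ⟨P, hP, hPeq⟩ := h
  refine exists_isPareSolution_of_supersolution hQ hR ⟨hc.trans hcc', hc'⟩ hP.posSemidef
    fun x => ?_
  nth_rewrite 2 [hPeq]
  rw [quad_pareMap hP.isHermitian, quad_pareMap hP.isHermitian]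
  have := quad_nonneg
    (inputWeight_posDef (d := d) (A := A) (B := B) hR hP.posSemidef).inv.posSemidef
    ((Bᵀ * P * A) *ᵥ x)
  nlinarith

/-- The adjoint second-moment map `M ↦ F'MF + H'MH` of the system `x⁺ = F x + ν H x` driven by
white noise `ν`. -/
def momentMap (F H : Matrix (Fin n) (Fin n) ℝ) :
    Matrix (Fin n) (Fin n) ℝ →ₗ[ℝ] Matrix (Fin n) (Fin n) ℝ where
  toFun M := Fᵀ * M * F + Hᵀ * M * H
  map_add' M M' := by simp only [Matrix.mul_add, Matrix.add_mul]; abel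
  map_smul' a M := by simp

theorem quad_momentMap (F H M : Matrix (Fin n) (Fin n) ℝ) (x : Fin n → ℝ) :
    quad (momentMap F H M) x = quad M (F *ᵥ x) + quad M (H *ᵥ x) := by
  change quad (Fᵀ * M * F + Hᵀ * M * H) x = _
  rw [quad_add, quad_conj, quad_conj]

theorem posSemidef_momentMap_pow (F H : Matrix (Fin n) (Fin n) ℝ) (k : ℕ) :
    ((momentMap F H ^ k) 1).PosSemidef := by
  induction k with
  | zero => simpa using PosSemidef.one
  | succ k ih =>
    rw [pow_succ', Module.End.mul_apply]
    exact (posSemidef_conj ih F).add (posSemidef_conj ih H)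

/-- A feedback gain under which the second moments decay yields a solution of the PARE with
parameter `1`. The supersolution is a multiple of `∑_{j<k} T^j 1`, where `T` is the moment map and
`k` is so large that `T^k 1 ≤ 1/2`. -/
theorem exists_isPareSolution_one (hQ : Q.PosDef) (hR : R.PosDef) (K : Matrix (Fin m) (Fin n) ℝ)
    (h : ∀ x, Tendsto (fun k => quad ((momentMap (A + B * K) (A ^ d * B * K) ^ k) 1) x)
      atTop (𝓝 0)) :
    ∃ P, IsPareSolution d A B Q R 1 P := by
  set T := momentMap (A + B * K) (A ^ d * B * K) with hT
  obtain ⟨k, hk⟩ : ∃ k, ∀ x, quad ((T ^ k) 1) x ≤ 1 / 2 * ∑ i, x i ^ 2 := by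
    obtain ⟨M', hM', hh, hq⟩ := exists_tendsto_of_tendsto_quad
      (fun k => (posSemidef_momentMap_pow (A + B * K) (A ^ d * B * K) k).isHermitian) h
    have hM0 : M' = 0 := by
      ext i j
      rw [apply_eq_quad hh]
      simp [hq]
    have hs : Tendsto (fun k => ∑ i, ∑ j, |((T ^ k) 1) i j|) atTop (𝓝 0) := by
      have hc : Continuous fun N : Matrix (Fin n) (Fin n) ℝ => ∑ i, ∑ j, |N i j| := by fun_prop
      have := (hc.tendsto M').comp hM'
      simpa [hM0, Function.comp_def] using this
    obtain ⟨k, hk⟩ := (hs.eventually (gt_mem_nhds (show (0 : ℝ) < 1 / 2 by norm_num))).exists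
    exact ⟨k, fun x => (quad_le_sum_abs_mul _ x).trans
      (mul_le_mul_of_nonneg_right hk.le (Finset.sum_nonneg fun i _ => sq_nonneg _))⟩
  set S := Q + Kᵀ * R * K
  set b := ∑ i, ∑ j, |S i j|
  have hb : 0 ≤ b := Finset.sum_nonneg fun i _ => Finset.sum_nonneg fun j _ => abs_nonneg _
  set X := (2 * b) • ∑ j ∈ Finset.range k, (T ^ j) 1 with hX
  have hXpsd : X.PosSemidef :=
    (posSemidef_sum _ fun j _ => posSemidef_momentMap_pow _ _ j).smul (by positivity)
  refine exists_isPareSolution_of_supersolution hQ hR (by simp) hXpsd fun x => ?_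
  refine (quad_pareMap_le_stageCost hR hXpsd zero_le_one x (K *ᵥ x)).trans ?_
  have h1 : stageCost d A B Q R 1 X x (K *ᵥ x) = quad (T X) x + quad S x := by
    rw [stageCost, hT, quad_momentMap, quad_add, quad_conj]
    simp only [add_mulVec, ← mulVec_mulVec]
    ring
  have h2 : T X - X = (2 * b) • ((T ^ k) 1 - 1) := by
    rw [hX, map_smul, map_sum, ← smul_sub, ← Finset.sum_sub_distrib]
    congr 1
    simpa [pow_succ'] using
      Finset.sum_range_sub (fun j => (T ^ j) (1 : Matrix (Fin n) (Fin n) ℝ)) k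
  have h3 : quad (T X) x - quad X x = 2 * b * (quad ((T ^ k) 1) x - ∑ i, x i ^ 2) := by
    rw [← quad_sub, h2, quad_smul, quad_sub, quad_one]
  have h4 : quad S x ≤ b * ∑ i, x i ^ 2 := quad_le_sum_abs_mul S x
  rw [h1]
  nlinarith [mul_le_mul_of_nonneg_left (hk x) hb]

end Riccati

/-! ### Second moments under centered noise -/

section Noise

/-- The σ-algebra generated by the noise at the times before `k`. -/
abbrev noisePast {Ω : Type*} (ξ : ℕ → Ω → ℝ) (k : ℕ) : MeasurableSpace Ω :=
  ⨆ j ∈ Set.Iio k, MeasurableSpace.comap (ξ j) inferInstance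

theorem noisePast_mono {Ω : Type*} {ξ : ℕ → Ω → ℝ} : Monotone (noisePast ξ) := fun _ _ h =>
  biSup_mono fun _ hj => lt_of_lt_of_le hj h

theorem measurable_noisePast {Ω : Type*} (ξ : ℕ → Ω → ℝ) (k : ℕ) :
    Measurable[noisePast ξ (k + 1)] (ξ k) :=
  Measurable.mono (comap_measurable (ξ k))
    (le_biSup (fun j => MeasurableSpace.comap (ξ j) inferInstance) (Nat.lt_succ_self k)) le_rfl

variable {Ω : Type*} [MeasurableSpace Ω] {Pr : Measure Ω} {ξ : ℕ → Ω → ℝ} {s2 : ℝ}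

/-- Independent square-integrable random variables with mean zero and common variance `s2`,
measurable and not merely almost everywhere measurable. -/
structure IsCenteredNoise (Pr : Measure Ω) (s2 : ℝ) (ξ : ℕ → Ω → ℝ) : Prop where
  measurable : ∀ k, Measurable (ξ k)
  memLp : ∀ k, MemLp (ξ k) 2 Pr
  indep : iIndepFun ξ Pr
  mean : ∀ k, ∫ ω, ξ k ω ∂Pr = 0
  variance : ∀ k, ∫ ω, ξ k ω ^ 2 ∂Pr = s2

theorem IsCenteredNoise.indepFun (hξ : IsCenteredNoise Pr s2 ξ) {k : ℕ} {q : Ω → ℝ}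
    (hq : Measurable[noisePast ξ k] q) : IndepFun (ξ k) q Pr := by
  have h := indep_iSup_of_disjoint (fun j => (hξ.measurable j).comap_le)
    ((iIndepFun_iff_iIndep _ _ _).1 hξ.indep)
    (show Disjoint ({k} : Set ℕ) (Set.Iio k) by simp)
  rw [IndepFun_iff_Indep]
  rw [iSup_singleton] at h
  exact indep_of_indep_of_le_right h hq.comap_le

theorem IsCenteredNoise.integrable_mul (hξ : IsCenteredNoise Pr s2 ξ) [IsProbabilityMeasure Pr]
    {k : ℕ} {q : Ω → ℝ} (hq : Measurable[noisePast ξ k] q) (hi : Integrable q Pr) :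
    Integrable (fun ω => ξ k ω * q ω) Pr :=
  (hξ.indepFun hq).integrable_mul ((hξ.memLp k).integrable (by norm_num)) hi

theorem IsCenteredNoise.integral_mul (hξ : IsCenteredNoise Pr s2 ξ) {k : ℕ} {q : Ω → ℝ}
    (hq : Measurable[noisePast ξ k] q) (hi : Integrable q Pr) :
    ∫ ω, ξ k ω * q ω ∂Pr = 0 := by
  rw [(hξ.indepFun hq).integral_fun_mul_eq_mul_integral
    (hξ.measurable k).aestronglyMeasurable hi.aestronglyMeasurable, hξ.mean, zero_mul]

theorem IsCenteredNoise.indepFun_sq (hξ : IsCenteredNoise Pr s2 ξ) {k : ℕ} {q : Ω → ℝ}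
    (hq : Measurable[noisePast ξ k] q) : IndepFun (fun ω => ξ k ω ^ 2) q Pr :=
  (hξ.indepFun hq).comp (φ := fun t : ℝ => t ^ 2) (ψ := id) (by fun_prop) measurable_id

theorem IsCenteredNoise.integrable_sq_mul (hξ : IsCenteredNoise Pr s2 ξ) {k : ℕ} {q : Ω → ℝ}
    (hq : Measurable[noisePast ξ k] q) (hi : Integrable q Pr) :
    Integrable (fun ω => ξ k ω ^ 2 * q ω) Pr :=
  (hξ.indepFun_sq hq).integrable_mul (hξ.memLp k).integrable_sq hi

theorem IsCenteredNoise.integral_sq_mul (hξ : IsCenteredNoise Pr s2 ξ) {k : ℕ} {q : Ω → ℝ}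
    (hq : Measurable[noisePast ξ k] q) (hi : Integrable q Pr) :
    ∫ ω, ξ k ω ^ 2 * q ω ∂Pr = s2 * ∫ ω, q ω ∂Pr := by
  rw [(hξ.indepFun_sq hq).integral_fun_mul_eq_mul_integral
    (hξ.memLp k).integrable_sq.aestronglyMeasurable hi.aestronglyMeasurable, hξ.variance]

/-- The square-integrable random variables that depend only on the noise before time `k`. -/
def adaptedL2 (Pr : Measure Ω) (ξ : ℕ → Ω → ℝ) (k : ℕ) : Submodule ℝ (Ω → ℝ) where
  carrier := {f | Measurable[noisePast ξ k] f ∧ MemLp f 2 Pr}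
  add_mem' hf hh :=
    ⟨Measurable.add (m := noisePast ξ k) hf.1 hh.1, hf.2.add hh.2⟩
  zero_mem' := ⟨@measurable_const _ _ _ (noisePast ξ k) _, MemLp.zero⟩
  smul_mem' c _ hf :=
    ⟨Measurable.fun_mul (m := noisePast ξ k)
      (@measurable_const _ _ _ (noisePast ξ k) _) hf.1, hf.2.const_smul c⟩

theorem mem_adaptedL2 {k : ℕ} {f : Ω → ℝ} :
    f ∈ adaptedL2 Pr ξ k ↔ Measurable[noisePast ξ k] f ∧ MemLp f 2 Pr := by
  change f ∈ {f | Measurable[noisePast ξ k] f ∧ MemLp f 2 Pr} ↔ _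
  rw [Set.mem_ofPred_eq]

theorem adaptedL2_mono {k l : ℕ} (h : k ≤ l) : adaptedL2 Pr ξ k ≤ adaptedL2 Pr ξ l :=
  fun _ hf => mem_adaptedL2.2
    ⟨(mem_adaptedL2.1 hf).1.mono (noisePast_mono h) le_rfl, (mem_adaptedL2.1 hf).2⟩

theorem const_mem_adaptedL2 [IsProbabilityMeasure Pr] (k : ℕ) (c : ℝ) :
    (fun _ => c) ∈ adaptedL2 Pr ξ k :=
  mem_adaptedL2.2 ⟨@measurable_const _ _ _ (noisePast ξ k) _, memLp_const c⟩

theorem IsCenteredNoise.mul_mem_adaptedL2 (hξ : IsCenteredNoise Pr s2 ξ) {k : ℕ} {f : Ω → ℝ}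
    (hf : f ∈ adaptedL2 Pr ξ k) : (fun ω => ξ k ω * f ω) ∈ adaptedL2 Pr ξ (k + 1) := by
  rw [mem_adaptedL2] at hf ⊢
  refine ⟨Measurable.fun_mul (m := noisePast ξ (k + 1)) (measurable_noisePast ξ k)
    (hf.1.mono (noisePast_mono k.le_succ) le_rfl), ?_⟩
  have hm : AEStronglyMeasurable (fun ω => ξ k ω * f ω) Pr :=
    (hξ.measurable k).aestronglyMeasurable.mul hf.2.aestronglyMeasurable
  rw [memLp_two_iff_integrable_sq hm]
  have hq : Measurable[noisePast ξ k] fun ω => f ω ^ 2 :=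
    Measurable.pow_const (m := noisePast ξ k) hf.1 2
  refine (hξ.integrable_sq_mul hq hf.2.integrable_sq).congr (ae_of_all _ fun ω => ?_)
  simp only [mul_pow]

/-- The vector-valued function `f` has all its entries in the space `S` of scalar functions. -/
def EntriesIn {X ι : Type*} (S : Submodule ℝ (X → ℝ)) (f : X → ι → ℝ) : Prop :=
  ∀ i, (fun x => f x i) ∈ S

namespace EntriesIn

section Algebra

variable {X ι κ : Type*} {S : Submodule ℝ (X → ℝ)} {f h : X → ι → ℝ}

theorem mono {S' : Submodule ℝ (X → ℝ)} (hf : EntriesIn S f) (hS : S ≤ S') : EntriesIn S' f :=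
  fun i => hS (hf i)

theorem add (hf : EntriesIn S f) (hh : EntriesIn S h) : EntriesIn S fun x => f x + h x :=
  fun i => S.add_mem (hf i) (hh i)

theorem sub (hf : EntriesIn S f) (hh : EntriesIn S h) : EntriesIn S fun x => f x - h x :=
  fun i => S.sub_mem (hf i) (hh i)

theorem smul (hf : EntriesIn S f) (c : ℝ) : EntriesIn S fun x => c • f x :=
  fun i => S.smul_mem c (hf i)

theorem sum {α : Type*} [Fintype α] {F : α → X → ι → ℝ} (hF : ∀ a, EntriesIn S (F a)) :
    EntriesIn S fun x => ∑ a, F a x := by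
  intro i
  have := S.sum_mem (t := Finset.univ) (f := fun a x => F a x i) fun a _ => hF a i
  convert this using 1
  ext x
  simp

theorem mulVec [Fintype ι] (hf : EntriesIn S f) (M : Matrix κ ι ℝ) :
    EntriesIn S fun x => M *ᵥ f x := by
  intro i
  have := S.sum_mem (t := Finset.univ) (f := fun j x => M i j * f x j)
    fun j _ => S.smul_mem (M i j) (hf j)
  convert this using 1
  ext x
  simp [Matrix.mulVec, dotProduct]

end Algebra

variable {ι κ : Type*} {k : ℕ} {f h : Ω → ι → ℝ}

theorem const [IsProbabilityMeasure Pr] (k : ℕ) (x : ι → ℝ) :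
    EntriesIn (adaptedL2 Pr ξ k) fun _ => x := fun i => const_mem_adaptedL2 k (x i)

theorem succ (hf : EntriesIn (adaptedL2 Pr ξ k) f) : EntriesIn (adaptedL2 Pr ξ (k + 1)) f :=
  hf.mono (adaptedL2_mono k.le_succ)

theorem noise_smul (hξ : IsCenteredNoise Pr s2 ξ) (hf : EntriesIn (adaptedL2 Pr ξ k) f) :
    EntriesIn (adaptedL2 Pr ξ (k + 1)) fun ω => ξ k ω • f ω := fun i => hξ.mul_mem_adaptedL2 (hf i)

variable [Fintype ι]

theorem measurable_dotProduct (hf : EntriesIn (adaptedL2 Pr ξ k) f)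
    (hh : EntriesIn (adaptedL2 Pr ξ k) h) :
    Measurable[noisePast ξ k] fun ω => f ω ⬝ᵥ h ω :=
  Finset.measurable_fun_sum (m := noisePast ξ k) Finset.univ fun i _ =>
    Measurable.fun_mul (m := noisePast ξ k) (mem_adaptedL2.1 (hf i)).1
      (mem_adaptedL2.1 (hh i)).1

theorem integrable_dotProduct (hf : EntriesIn (adaptedL2 Pr ξ k) f)
    (hh : EntriesIn (adaptedL2 Pr ξ k) h) :
    Integrable (fun ω => f ω ⬝ᵥ h ω) Pr :=
  integrable_finsetSum _ fun i _ =>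
    (mem_adaptedL2.1 (hf i)).2.integrable_mul (mem_adaptedL2.1 (hh i)).2

theorem integrable_quad (hf : EntriesIn (adaptedL2 Pr ξ k) f) (M : Matrix ι ι ℝ) :
    Integrable (fun ω => quad M (f ω)) Pr := hf.integrable_dotProduct (hf.mulVec M)

/-- The cross terms vanish because the noise at time `k` is centered and independent of the
past. -/
theorem integral_quad_add_noise_smul [IsProbabilityMeasure Pr] (hξ : IsCenteredNoise Pr s2 ξ)
    (hf : EntriesIn (adaptedL2 Pr ξ k) f)
    (hh : EntriesIn (adaptedL2 Pr ξ k) h) (M : Matrix ι ι ℝ) :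
    ∫ ω, quad M (f ω + ξ k ω • h ω) ∂Pr
      = ∫ ω, quad M (f ω) ∂Pr + s2 * ∫ ω, quad M (h ω) ∂Pr := by
  have hx : ∀ ω, quad M (f ω + ξ k ω • h ω) = quad M (f ω)
      + (ξ k ω * (f ω ⬝ᵥ M *ᵥ h ω) + ξ k ω * (h ω ⬝ᵥ M *ᵥ f ω))
      + ξ k ω ^ 2 * quad M (h ω) := by
    intro ω
    simp only [quad, mulVec_add, mulVec_smul, add_dotProduct, dotProduct_add, smul_dotProduct,
      dotProduct_smul, smul_eq_mul]
    ring
  have m1 := hf.measurable_dotProduct (hh.mulVec M)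
  have m2 := hh.measurable_dotProduct (hf.mulVec M)
  have m3 : Measurable[noisePast ξ k] fun ω => quad M (h ω) :=
    hh.measurable_dotProduct (hh.mulVec M)
  have i1 := hf.integrable_dotProduct (hh.mulVec M)
  have i2 := hh.integrable_dotProduct (hf.mulVec M)
  have i3 : Integrable (fun ω => quad M (h ω)) Pr := hh.integrable_quad M
  have j1 := hξ.integrable_mul m1 i1
  have j2 := hξ.integrable_mul m2 i2
  have j12 : Integrable (fun ω => ξ k ω * (f ω ⬝ᵥ M *ᵥ h ω) + ξ k ω * (h ω ⬝ᵥ M *ᵥ f ω)) Pr :=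
    j1.add j2
  have j : Integrable (fun ω => quad M (f ω)
      + (ξ k ω * (f ω ⬝ᵥ M *ᵥ h ω) + ξ k ω * (h ω ⬝ᵥ M *ᵥ f ω))) Pr :=
    (hf.integrable_quad M).add j12
  simp only [hx]
  rw [integral_add j (hξ.integrable_sq_mul m3 i3), integral_add (hf.integrable_quad M) j12,
    integral_add j1 j2, hξ.integral_mul m1 i1, hξ.integral_mul m2 i2, hξ.integral_sq_mul m3 i3]
  ring

end EntriesIn

theorem sqNorm_eq {n : ℕ} (v : Fin n → ℝ) : sqNorm v = ∑ i, v i ^ 2 := by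
  simp [sqNorm, EuclideanSpace.norm_sq_eq]

/-- The packet process, centered at its mean. -/
theorem IsPacketProcess.isCenteredNoise [IsProbabilityMeasure Pr] {p : ℝ}
    (hp : p ∈ Set.Ioo (0 : ℝ) 1) {g : ℕ → Ω → ℝ} (hg : IsPacketProcess Pr p g) :
    IsCenteredNoise Pr (p * (1 - p)) fun k ω => g k ω - (1 - p) := by
  have hmeas : ∀ k (a : ℝ), MeasurableSet {ω | g k ω = a} := fun k a =>
    hg.measurable k (measurableSet_singleton a)
  have h01 : ∀ k, ∀ᵐ ω ∂Pr, g k ω = 0 ∨ g k ω = 1 := by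
    intro k
    have hd : Disjoint {ω | g k ω = 0} {ω | g k ω = 1} := by
      rw [Set.disjoint_left]
      intro ω h0 h1
      simp only [Set.mem_ofPred_eq] at h0 h1
      linarith
    have hu : Pr ({ω | g k ω = 0} ∪ {ω | g k ω = 1}) = 1 := by
      rw [measure_union hd (hmeas k 1), hg.prob_zero, hg.prob_one,
        ← ENNReal.ofReal_add hp.1.le (by linarith [hp.2])]
      simp
    have := (prob_compl_eq_zero_iff ((hmeas k 0).union (hmeas k 1))).2 hu
    rw [ae_iff]
    exact this
  have hind : ∀ k, g k =ᵐ[Pr] {ω | g k ω = 1}.indicator fun _ => 1 := by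
    intro k
    filter_upwards [h01 k] with ω hω
    rcases hω with h | h <;> simp [Set.indicator, h]
  have hmem : ∀ k, MemLp (g k) 2 Pr := fun k =>
    (memLp_congr_ae (hind k)).2 ((memLp_const (1 : ℝ)).indicator (hmeas k 1))
  have hint : ∀ k, Integrable (g k) Pr := fun k => (hmem k).integrable (by norm_num)
  have hmean : ∀ k, ∫ ω, g k ω ∂Pr = 1 - p := by
    intro k
    rw [integral_congr_ae (hind k), integral_indicator_const _ (hmeas k 1), measureReal_def,
      hg.prob_one, ENNReal.toReal_ofReal (by linarith [hp.2])]
    simp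
  refine ⟨fun k => (hg.measurable k).sub_const _, fun k => (hmem k).sub (memLp_const _),
    hg.indep.comp (fun _ t => t - (1 - p)) fun _ => by fun_prop, fun k => ?_, fun k => ?_⟩
  · rw [integral_sub (hint k) (integrable_const _), hmean]
    simp
  · have : (fun ω => (g k ω - (1 - p)) ^ 2) =ᵐ[Pr]
        fun ω => (1 - 2 * (1 - p)) * g k ω + (1 - p) ^ 2 := by
      filter_upwards [h01 k] with ω hω
      rcases hω with h | h <;> rw [h] <;> ring
    rw [integral_congr_ae this, integral_add ((hint k).const_mul _) (integrable_const _),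
      integral_const_mul, hmean]
    simp
    ring

/-- White noise, only almost everywhere measurable, has a measurable version. -/
theorem IsWhiteNoise.exists_isCenteredNoise {ν : ℕ → Ω → ℝ} (hν : IsWhiteNoise Pr ν) :
    ∃ ν', IsCenteredNoise Pr 1 ν' ∧ ∀ᵐ ω ∂Pr, ∀ k, ν k ω = ν' k ω := by
  have hm : ∀ k, AEMeasurable (ν k) Pr := fun k => (hν.memLp k).aestronglyMeasurable.aemeasurable
  have hae : ∀ k, ν k =ᵐ[Pr] (hm k).mk := fun k => (hm k).ae_eq_mk
  refine ⟨fun k => (hm k).mk, ⟨fun k => (hm k).measurable_mk,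
    fun k => (memLp_congr_ae (hae k)).1 (hν.memLp k), hν.indep.congr hae, fun k => ?_,
    fun k => ?_⟩, ae_all_iff.2 hae⟩
  · rw [← hν.mean k]
    exact integral_congr_ae (hae k).symm
  · rw [← hν.variance k]
    refine integral_congr_ae ?_
    filter_upwards [hae k] with ω hω
    rw [hω]

end Noise

/-! ### Mean-square stabilizability -/

section Stabilizable

variable {Ω : Type*} [MeasurableSpace Ω] {Pr : Measure Ω} [IsProbabilityMeasure Pr]
  {ν : ℕ → Ω → ℝ} {n m : ℕ} {A : Matrix (Fin n) (Fin n) ℝ} {B B₀ : Matrix (Fin n) (Fin m) ℝ}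
  {K : Matrix (Fin m) (Fin n) ℝ}

theorem noisePath_succ (ν : ℕ → ℝ) (x₀ : Fin n → ℝ) (k : ℕ) :
    noisePath A B 0 B₀ K ν x₀ (k + 1) = (A + B * K) *ᵥ noisePath A B 0 B₀ K ν x₀ k
      + ν k • ((B₀ * K) *ᵥ noisePath A B 0 B₀ K ν x₀ k) := by
  simp [noisePath, add_mulVec, mulVec_mulVec]

theorem adapted_noisePath {s2 : ℝ} (hν : IsCenteredNoise Pr s2 ν) (x₀ : Fin n → ℝ) (k : ℕ) :
    EntriesIn (adaptedL2 Pr ν k) fun ω => noisePath A B 0 B₀ K (fun t => ν t ω) x₀ k := by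
  induction k with
  | zero => exact EntriesIn.const 0 x₀
  | succ k ih =>
    simp only [noisePath_succ]
    exact (ih.mulVec _).succ.add ((ih.mulVec _).noise_smul hν)

theorem integral_quad_noisePath (hν : IsCenteredNoise Pr 1 ν) (x₀ : Fin n → ℝ) (k : ℕ)
    (M : Matrix (Fin n) (Fin n) ℝ) :
    ∫ ω, quad M (noisePath A B 0 B₀ K (fun t => ν t ω) x₀ k) ∂Pr
      = quad ((momentMap (A + B * K) (B₀ * K) ^ k) M) x₀ := by
  induction k generalizing M with
  | zero => simp [noisePath]
  | succ k ih =>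
    have h := adapted_noisePath (A := A) (B := B) (B₀ := B₀) (K := K) hν x₀ k
    simp only [noisePath_succ]
    rw [(h.mulVec _).integral_quad_add_noise_smul hν (h.mulVec _), one_mul,
      ← integral_add ((h.mulVec _).integrable_quad M) ((h.mulVec _).integrable_quad M),
      pow_succ, Module.End.mul_apply, ← ih]
    simp only [quad_momentMap]

theorem MeanSquareStabilizable.exists_tendsto_quad (hν : IsWhiteNoise Pr ν)
    (h : MeanSquareStabilizable Pr ν A B 0 B₀) :
    ∃ K : Matrix (Fin m) (Fin n) ℝ, ∀ x,
      Tendsto (fun k => quad ((momentMap (A + B * K) (B₀ * K) ^ k) 1) x) atTop (𝓝 0) := by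
  obtain ⟨K, hK⟩ := h
  obtain ⟨ν', hν', hae⟩ := hν.exists_isCenteredNoise
  refine ⟨K, fun x => (hK x).congr fun k => ?_⟩
  rw [← integral_quad_noisePath hν']
  refine integral_congr_ae ?_
  filter_upwards [hae] with ω hω
  rw [quad_one, sqNorm_eq, funext hω]

end Stabilizable

/-! ### Eigenvectors of the Laplacian -/

namespace WeightedGraph

variable {N : ℕ} (G : WeightedGraph N)

theorem weight_comm (i j : Fin N) : G.weight i j = G.weight j i := G.symm.apply j i

theorem laplacian_mulVec_apply (x : Fin N → ℝ) (i : Fin N) :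
    (G.laplacian *ᵥ x) i = ∑ j, G.weight i j * (x i - x j) := by
  simp only [laplacian, sub_mulVec, mulVec_diagonal, Pi.sub_apply, mul_sub,
    Finset.sum_sub_distrib, Finset.sum_mul]
  rfl

theorem laplacian_mulVec_const (c : ℝ) : G.laplacian *ᵥ (fun _ => c) = 0 := by
  ext i
  simp [laplacian_mulVec_apply]

theorem quad_laplacian (x : Fin N → ℝ) :
    quad G.laplacian x = (∑ i, ∑ j, G.weight i j * (x i - x j) ^ 2) / 2 := by
  have h1 : quad G.laplacian x = ∑ i, ∑ j, G.weight i j * (x i * (x i - x j)) := by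
    simp only [quad, dotProduct, laplacian_mulVec_apply, Finset.mul_sum]
    exact Finset.sum_congr rfl fun i _ => Finset.sum_congr rfl fun j _ => by ring
  have h2 : quad G.laplacian x = ∑ i, ∑ j, G.weight i j * (x j * (x j - x i)) := by
    rw [h1, Finset.sum_comm]
    exact Finset.sum_congr rfl fun i _ => Finset.sum_congr rfl fun j _ => by
      rw [G.weight_comm]
  have h3 : ∑ i, ∑ j, G.weight i j * (x i - x j) ^ 2 = quad G.laplacian x
      + quad G.laplacian x := by
    nth_rewrite 1 [h1]
    rw [h2]
    simp only [← Finset.sum_add_distrib]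
    exact Finset.sum_congr rfl fun i _ => Finset.sum_congr rfl fun j _ => by ring
  rw [h3]
  ring

theorem laplacian_posSemidef : G.laplacian.PosSemidef := by
  refine posSemidef_of_quad G.laplacian_isHermitian fun x => ?_
  rw [quad_laplacian]
  exact div_nonneg (Finset.sum_nonneg fun i _ => Finset.sum_nonneg fun j _ =>
    mul_nonneg (G.nonneg i j) (sq_nonneg _)) (by norm_num)

/-- The enumeration of the Laplacian eigenvalues by `lapEigenvalue` is a permutation of
Mathlib's `eigenvalues`, which are indexed like the eigenvector basis. -/
theorem exists_equiv_eigenvalues : ∃ e : Fin N ≃ Fin N,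
    ∀ i, G.lapEigenvalue i = G.laplacian_isHermitian.eigenvalues (e i) := by
  refine ⟨(Fin.revPerm.trans (finCongr (Fintype.card_fin N).symm)).trans
    (Fintype.equivOfCardEq (Fintype.card_fin _)), fun i => ?_⟩
  simp [lapEigenvalue, Matrix.IsHermitian.eigenvalues]

theorem lapEigenvalue_mono : Monotone G.lapEigenvalue := fun i j hij =>
  G.laplacian_isHermitian.eigenvalues₀_antitone (by simpa using hij)

theorem lapEigenvalue_nonneg (i : Fin N) : 0 ≤ G.lapEigenvalue i := by
  obtain ⟨e, he⟩ := G.exists_equiv_eigenvalues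
  rw [he]
  exact G.laplacian_posSemidef.eigenvalues_nonneg _

/-- An orthonormal basis of Laplacian eigenvectors when `λ₂ > 0`. Each basis vector is either
constant or belongs to an eigenvalue in `[λ₂, λ_N]`. Orthonormality is stated as the resolution
of the identity. -/
theorem exists_eigenbasis (hN : 2 ≤ N) (h2 : 0 < G.lamTwo hN) :
    ∃ (v : Fin N → Fin N → ℝ) (lam : Fin N → ℝ),
      (∀ l, G.laplacian *ᵥ v l = lam l • v l) ∧
      (∀ j r, ∑ l, v l j * v l r = if j = r then 1 else 0) ∧
      ∀ l, (∀ i j, v l i = v l j) ∨ lam l ∈ Set.Icc (G.lamTwo hN) (G.lamMax hN) := by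
  classical
  obtain ⟨e, he⟩ := G.exists_equiv_eigenvalues
  set b := G.laplacian_isHermitian.eigenvectorBasis
  set v : Fin N → Fin N → ℝ := fun l => (b (e l)).ofLp with hv
  have heig : ∀ l, G.laplacian *ᵥ v l = G.lapEigenvalue l • v l := fun l => by
    rw [he]
    exact G.laplacian_isHermitian.mulVec_eigenvectorBasis (e l)
  have hexp : ∀ x : Fin N → ℝ, ∑ l, (x ⬝ᵥ v l) • v l = x := by
    intro x
    have := congrArg WithLp.ofLp (b.sum_repr' (WithLp.toLp 2 x))
    rw [← e.sum_comp] at this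
    simpa [EuclideanSpace.inner_eq_star_dotProduct, hv] using this
  refine ⟨v, G.lapEigenvalue, heig, fun j r => ?_, fun l => ?_⟩
  · have := congrFun (hexp (Pi.single j 1)) r
    simpa [Pi.single_apply, eq_comm] using this
  · have hmax : G.lapEigenvalue l ≤ G.lamMax hN :=
      G.lapEigenvalue_mono (Fin.mk_le_mk.2 (by omega) : l ≤ ⟨N - 1, by omega⟩)
    have hlow : ∀ l' : Fin N, (l' : ℕ) ≠ 0 → G.lamTwo hN ≤ G.lapEigenvalue l' := fun l' hl' =>
      G.lapEigenvalue_mono (Fin.mk_le_mk.2 (by omega) : (⟨1, by omega⟩ : Fin N) ≤ l')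
    by_cases hl : (l : ℕ) = 0
    · left
      -- the constant vector lies in the kernel, so it is orthogonal to all the other eigenvectors
      have horth : ∀ l', l' ≠ l → (fun _ => (1 : ℝ)) ⬝ᵥ v l' = 0 := by
        intro l' hne
        have hpos := h2.trans_le (hlow l' fun h0 => hne (Fin.ext (h0.trans hl.symm)))
        have h3 := dotProduct_mulVec_comm_of_isHermitian G.laplacian_isHermitian
          (fun _ => (1 : ℝ)) (v l')
        rw [laplacian_mulVec_const, heig, dotProduct_zero, dotProduct_smul, smul_eq_mul] at h3
        exact (mul_eq_zero.1 h3.symm).resolve_left hpos.ne'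
      have hone := hexp fun _ => 1
      rw [Finset.sum_eq_single l (fun l' _ hne => by rw [horth l' hne, zero_smul])
        (by simp)] at hone
      intro i j
      have hi := congrFun hone i
      have hj := congrFun hone j
      simp only [Pi.smul_apply, smul_eq_mul] at hi hj
      exact mul_left_cancel₀ (left_ne_zero_of_mul_eq_one hi) (hi.trans hj.symm)
    · exact Or.inr ⟨hlow l hl, hmax⟩

end WeightedGraph

/-! ### The Lyapunov inequality of the consensus gain -/

section Gain

variable {n m : ℕ} {d : ℕ} {A : Matrix (Fin n) (Fin n) ℝ} {B : Matrix (Fin n) (Fin m) ℝ}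
  {Q : Matrix (Fin n) (Fin n) ℝ} {R : Matrix (Fin m) (Fin m) ℝ}

theorem mulVec_injective_of_rank_eq (hB : B.rank = m) : Function.Injective B.mulVec := by
  have h := B.mulVecLin.finrank_range_add_finrank_ker
  have hr : Module.finrank ℝ B.mulVecLin.range = m := hB
  rw [hr, Module.finrank_fin_fun] at h
  have hk : B.mulVecLin.ker = ⊥ := Submodule.finrank_eq_zero.1 (by omega)
  exact LinearMap.ker_eq_bot.1 hk

/-- The matrix `μ² B'PB + σ² B'(A')^d P A^d B` inverted in the consensus gain. -/
def gainWeight (d : ℕ) (A : Matrix (Fin n) (Fin n) ℝ) (B : Matrix (Fin n) (Fin m) ℝ) (p : ℝ)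
    (P : Matrix (Fin n) (Fin n) ℝ) : Matrix (Fin m) (Fin m) ℝ :=
  (1 - p) ^ 2 • (Bᵀ * P * B) + (p * (1 - p)) • (Bᵀ * Aᵀ ^ d * P * A ^ d * B)

theorem gainWeight_posDef (hB : B.rank = m) {p : ℝ} (hp : p ∈ Set.Ioo (0 : ℝ) 1)
    {P : Matrix (Fin n) (Fin n) ℝ} (hP : P.PosDef) : (gainWeight d A B p P).PosDef := by
  have h1 : 0 < 1 - p := by linarith [hp.2]
  have h2 : (Bᵀ * P * B).PosDef := by
    simpa [conjTranspose_eq_transpose_of_trivial] using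
      hP.conjTranspose_mul_mul_same (mulVec_injective_of_rank_eq hB)
  exact (h2.smul (pow_pos h1 2)).add_posSemidef
    ((posSemidef_delayed_input hP.posSemidef).smul (mul_nonneg hp.1.le h1.le))

theorem quad_gainWeight (p : ℝ) (P : Matrix (Fin n) (Fin n) ℝ) (u : Fin m → ℝ) :
    quad (gainWeight d A B p P) u
      = (1 - p) ^ 2 * quad P (B *ᵥ u) + p * (1 - p) * quad P ((A ^ d * B) *ᵥ u) := by
  rw [gainWeight, quad_add, quad_smul, quad_smul, quad_conj, quad_delayed_input]

/-- The Lyapunov inequality for the mode with eigenvalue `l`. The closed-loop form is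
`z'A'PAz - (2μt - t²) q` with `t = 2μl/(l₂ + l_N)` and `q` the form of `W⁻¹` at `B'PAz`, where `W`
is the weight in the gain; the coefficient is least at the end points `l₂` and `l_N`, and
`W ≤ (μ² + σ²) (R + B'PB + B'(A')^d P A^d B)` turns the bound into the PARE. -/
theorem lyapunov_inequality {N : ℕ} {G : WeightedGraph N} {hN : 2 ≤ N} (hB : B.rank = m) {p : ℝ}
    (hp : p ∈ Set.Ioo (0 : ℝ) 1) (hR : R.PosDef) (h2 : 0 < G.lamTwo hN)
    {P : Matrix (Fin n) (Fin n) ℝ} (hP : IsPareSolution d A B Q R (gammaTwo p G hN) P) {l : ℝ}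
    (hl : l ∈ Set.Icc (G.lamTwo hN) (G.lamMax hN)) (z : Fin n → ℝ) :
    quad P (A *ᵥ z + (1 - p) • B *ᵥ (-l) • consensusGain d A B p G hN P *ᵥ z)
      + p * (1 - p) * quad P ((A ^ d * B) *ᵥ (-l) • consensusGain d A B p G hN P *ᵥ z)
      ≤ quad P z - quad Q z := by
  obtain ⟨hPd, hPe⟩ := hP
  have hμ : 0 < 1 - p := by linarith [hp.2]
  set a := G.lamTwo hN with ha
  set b := G.lamMax hN with hb
  have hab : 0 < a + b := by linarith [hl.1, hl.2]
  set W := gainWeight d A B p P with hWdef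
  have hW : W.PosDef := gainWeight_posDef hB hp hPd
  set y := (Bᵀ * P * A) *ᵥ z with hy
  set s := (1 - p) ^ 2 + p * (1 - p) with hs
  have hs0 : 0 < s := by have := mul_pos hp.1 hμ; positivity
  set t := l * (2 * (1 - p) / (a + b)) with ht
  set u := (-l) • consensusGain d A B p G hN P *ᵥ z with hu
  have hu' : u = (-t) • W⁻¹ *ᵥ y := by
    rw [hu, consensusGain, ← gainWeight, ← hWdef, hy, mulVec_mulVec, smul_mulVec, smul_smul,
      ← Matrix.mul_assoc, ← Matrix.mul_assoc, ht, neg_mul]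
  obtain ⟨huy, huu⟩ := forms_smul_inv_mulVec hW y (-t)
  rw [← hu'] at huy huu
  have hcl : quad P (A *ᵥ z + (1 - p) • B *ᵥ u) + p * (1 - p) * quad P ((A ^ d * B) *ᵥ u)
      = quad P (A *ᵥ z) + 2 * (1 - p) * (u ⬝ᵥ y) + quad W u := by
    have h : (B *ᵥ u) ⬝ᵥ P *ᵥ A *ᵥ z = u ⬝ᵥ y := by
      rw [hy, ← mulVec_mulVec, ← mulVec_mulVec, dotProduct_mulVec u, vecMul_transpose]
    rw [quad_add_vec hPd.isHermitian, quad_smul_vec, smul_dotProduct, h, quad_gainWeight,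
      smul_eq_mul]
    ring
  have hPz : quad P z = quad P (A *ᵥ z) + quad Q z
      - gammaTwo p G hN * quad (inputWeight d A B R P)⁻¹ y := by
    conv_lhs => rw [hPe]
    rw [quad_pareMap hPd.isHermitian]
  have hq : quad (inputWeight d A B R P)⁻¹ y ≤ s * quad W⁻¹ y := by
    refine quad_inv_le_mul_quad_inv (inputWeight_posDef hR hPd.posSemidef) hW hs0
      (fun w => ?_) y
    rw [quad_gainWeight, quad_inputWeight]
    have i1 := quad_nonneg hR.posSemidef w
    have i2 := quad_nonneg hPd.posSemidef (B *ᵥ w)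
    have i3 := quad_nonneg hPd.posSemidef ((A ^ d * B) *ᵥ w)
    have j1 := mul_nonneg hs0.le i1
    have j2 := mul_nonneg (mul_nonneg hp.1.le hμ.le) i2
    have j3 := mul_nonneg (sq_nonneg (1 - p)) i3
    rw [hs] at j1 ⊢
    linarith
  have hq0 : 0 ≤ quad W⁻¹ y := quad_nonneg hW.inv.posSemidef y
  have hγ : gammaTwo p G hN = (1 - p) ^ 2 / s * (4 * a * b / (a + b) ^ 2) := rfl
  have hb0 : 0 < b := by linarith [hl.1, hl.2]
  have hγ0 : 0 ≤ gammaTwo p G hN := by rw [hγ]; positivity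
  have hco : gammaTwo p G hN * s ≤ 2 * (1 - p) * t - t ^ 2 := by
    have e1 : gammaTwo p G hN * s = (1 - p) ^ 2 * 4 * (a * b) / (a + b) ^ 2 := by
      rw [hγ]
      field_simp
    have e2 : 2 * (1 - p) * t - t ^ 2 = (1 - p) ^ 2 * 4 * (l * (a + b - l)) / (a + b) ^ 2 := by
      rw [ht]
      field_simp
      ring
    rw [e1, e2]
    have : a * b ≤ l * (a + b - l) := by
      nlinarith [mul_nonneg (sub_nonneg.2 hl.1) (sub_nonneg.2 hl.2)]
    gcongr
  have h1 := mul_le_mul_of_nonneg_left hq hγ0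
  have h2 := mul_le_mul_of_nonneg_right hco hq0
  rw [hcl, hPz, huy, huu]
  nlinarith

theorem gammaTwo_le_one {N : ℕ} (G : WeightedGraph N) (hN : 2 ≤ N) {p : ℝ}
    (hp : p ∈ Set.Ioo (0 : ℝ) 1) : gammaTwo p G hN ≤ 1 := by
  have hμ : 0 < 1 - p := by linarith [hp.2]
  have ha : 0 ≤ G.lamTwo hN := G.lapEigenvalue_nonneg _
  have hb : 0 ≤ G.lamMax hN := G.lapEigenvalue_nonneg _
  have hσ := mul_pos hp.1 hμ
  refine mul_le_one₀ (div_le_one_of_le₀ (by linarith) (by positivity)) (by positivity)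
    (div_le_one_of_le₀ ?_ (by positivity))
  nlinarith [sq_nonneg (G.lamTwo hN - G.lamMax hN)]

theorem lamTwo_pos_of_gammaTwo_pos {N : ℕ} {G : WeightedGraph N} {hN : 2 ≤ N} {p : ℝ}
    (h : 0 < gammaTwo p G hN) : 0 < G.lamTwo hN := by
  refine lt_of_le_of_ne (G.lapEigenvalue_nonneg _) fun h0 => ?_
  simp [gammaTwo, ← h0] at h

theorem criticalValue_nonneg : 0 ≤ criticalValue d A B Q R :=
  Real.sInf_nonneg fun _ hc => hc.1.1

/-- Above the critical value the PARE is solvable. Solvability with parameter `1` makes the set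
in the definition of the critical value nonempty, so that its infimum is not the junk value of
the empty set. -/
theorem exists_isPareSolution_of_criticalValue_lt (hQ : Q.PosDef) (hR : R.PosDef)
    (h1 : ∃ P, IsPareSolution d A B Q R 1 P) {c : ℝ} (hc : criticalValue d A B Q R < c)
    (hc1 : c ≤ 1) : ∃ P, IsPareSolution d A B Q R c P := by
  obtain ⟨c', ⟨hc', hP⟩, hlt⟩ := exists_lt_of_csInf_lt
    (s := {c | c ∈ Set.Icc (0 : ℝ) 1 ∧ ∃ P, IsPareSolution d A B Q R c P})
    ⟨1, by simpa using h1⟩ hc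
  exact exists_isPareSolution_of_le hQ hR hc'.1 hlt.le hc1 hP

theorem isUnit_det_of_one_le_spectrum
    (hA : ∀ z ∈ spectrum ℂ (A.map (algebraMap ℝ ℂ)), 1 ≤ ‖z‖) : IsUnit A.det := by
  have h0 : (0 : ℂ) ∉ spectrum ℂ (A.map (algebraMap ℝ ℂ)) := fun h => by
    have := hA 0 h
    norm_num at this
  rw [spectrum.zero_notMem_iff, isUnit_iff_isUnit_det] at h0
  have h := RingHom.map_det (algebraMap ℝ ℂ) A
  rw [RingHom.mapMatrix_apply] at h
  rw [← h] at h0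
  refine isUnit_iff_ne_zero.2 fun hd => ?_
  simp [hd] at h0

end Gain

/-! ### Convergence to zero in mean square -/

section MeanSquare

variable {Ω : Type*} [MeasurableSpace Ω] {Pr : Measure Ω}

/-- The sequences of square-integrable random variables that tend to zero in mean square. -/
def msNull (Pr : Measure Ω) : Submodule ℝ (ℕ × Ω → ℝ) where
  carrier := {F | (∀ k, MemLp (fun ω => F (k, ω)) 2 Pr) ∧
    Tendsto (fun k => ∫ ω, F (k, ω) ^ 2 ∂Pr) atTop (𝓝 0)}
  add_mem' {F H} hF hH := by
    refine ⟨fun k => (hF.1 k).add (hH.1 k), ?_⟩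
    have hlim := (hF.2.const_mul 2).add (hH.2.const_mul 2)
    rw [mul_zero, add_zero] at hlim
    refine squeeze_zero (fun k => integral_nonneg fun ω => sq_nonneg _) (fun k => ?_) hlim
    have iF := (hF.1 k).integrable_sq.const_mul 2
    have iH := (hH.1 k).integrable_sq.const_mul 2
    rw [← integral_const_mul, ← integral_const_mul, ← integral_add iF iH]
    refine integral_mono ((hF.1 k).add (hH.1 k)).integrable_sq (iF.add iH) fun ω => ?_
    simp only [Pi.add_apply]
    nlinarith [sq_nonneg (F (k, ω) - H (k, ω))]
  zero_mem' := ⟨fun k => MemLp.zero, by simp⟩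
  smul_mem' a F hF := by
    refine ⟨fun k => (hF.1 k).const_smul a, ?_⟩
    simpa [mul_pow, integral_const_mul] using hF.2.const_mul (a ^ 2)

theorem mem_msNull {F : ℕ × Ω → ℝ} : F ∈ msNull Pr ↔ (∀ k, MemLp (fun ω => F (k, ω)) 2 Pr) ∧
    Tendsto (fun k => ∫ ω, F (k, ω) ^ 2 ∂Pr) atTop (𝓝 0) := by
  change F ∈ {F : ℕ × Ω → ℝ | (∀ k, MemLp (fun ω => F (k, ω)) 2 Pr) ∧
    Tendsto (fun k => ∫ ω, F (k, ω) ^ 2 ∂Pr) atTop (𝓝 0)} ↔ _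
  rw [Set.mem_ofPred_eq]

theorem mem_msNull_of_shift {F : ℕ × Ω → ℝ} (hF : ∀ k, MemLp (fun ω => F (k, ω)) 2 Pr)
    (h : (fun y : ℕ × Ω => F (y.1 + 1, y.2)) ∈ msNull Pr) : F ∈ msNull Pr :=
  mem_msNull.2 ⟨hF, (tendsto_add_atTop_iff_nat 1).1 (mem_msNull.1 h).2⟩

theorem EntriesIn.tendsto_integral_sqNorm {n : ℕ} {f : ℕ × Ω → Fin n → ℝ}
    (hf : EntriesIn (msNull Pr) f) :
    Tendsto (fun k => ∫ ω, sqNorm (f (k, ω)) ∂Pr) atTop (𝓝 0) := by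
  simp only [sqNorm_eq]
  have h : ∀ k, ∫ ω, ∑ i, f (k, ω) i ^ 2 ∂Pr = ∑ i, ∫ ω, f (k, ω) i ^ 2 ∂Pr := fun k =>
    integral_finsetSum _ fun i _ => ((mem_msNull.1 (hf i)).1 k).integrable_sq
  simp only [h]
  simpa using tendsto_finsetSum Finset.univ fun i _ => (mem_msNull.1 (hf i)).2

/-- Cauchy-Schwarz for the form of `Q`: a coordinate is controlled by a positive definite form. -/
theorem sq_apply_le_mul_quad {ι : Type*} [Fintype ι] [DecidableEq ι] {Q : Matrix ι ι ℝ}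
    (hQ : Q.PosDef) (z : ι → ℝ) (i : ι) :
    z i ^ 2 ≤ quad Q⁻¹ (Pi.single i 1) * quad Q z := by
  rcases eq_or_ne z 0 with rfl | hz
  · simp [quad]
  have hpos := quad_pos hQ hz
  -- the optimal multiple of `z` in the variational formula for the inverse
  have h := neg_quad_inv_le hQ ((-(z i / quad Q z)) • z) (Pi.single i 1)
  rw [smul_dotProduct, dotProduct_single_one, quad_smul_vec, smul_eq_mul] at h
  have h1 : 2 * (-(z i / quad Q z) * z i) + (-(z i / quad Q z)) ^ 2 * quad Q z
      = -(z i ^ 2 / quad Q z) := by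
    field_simp
    ring
  rw [h1] at h
  exact (div_le_iff₀ hpos).1 (by linarith)

theorem entriesIn_msNull_of_tendsto_quad {n : ℕ} {Q : Matrix (Fin n) (Fin n) ℝ} (hQ : Q.PosDef)
    {ξ : ℕ → Ω → ℝ} {z : ℕ × Ω → Fin n → ℝ}
    (hz : ∀ k, EntriesIn (adaptedL2 Pr ξ k) fun ω => z (k, ω))
    (h : Tendsto (fun k => ∫ ω, quad Q (z (k, ω)) ∂Pr) atTop (𝓝 0)) :
    EntriesIn (msNull Pr) z := by
  intro i
  have hL : ∀ k, MemLp (fun ω => z (k, ω) i) 2 Pr := fun k => (mem_adaptedL2.1 (hz k i)).2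
  refine mem_msNull.2 ⟨hL, ?_⟩
  have hlim := h.const_mul (quad Q⁻¹ (Pi.single i 1))
  rw [mul_zero] at hlim
  refine squeeze_zero (fun k => integral_nonneg fun ω => sq_nonneg _) (fun k => ?_) hlim
  rw [← integral_const_mul]
  exact integral_mono (hL k).integrable_sq (((hz k).integrable_quad Q).const_mul _)
    fun ω => sq_apply_le_mul_quad hQ _ _

theorem tendsto_zero_of_lyapunov {V a : ℕ → ℝ} (hV : ∀ k, 0 ≤ V k) (ha : ∀ k, 0 ≤ a k)
    (h : ∀ k, V (k + 1) + a k ≤ V k) : Tendsto a atTop (𝓝 0) := by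
  have hanti : Antitone V := antitone_nat_of_succ_le fun k => by linarith [h k, ha k]
  have hlim := tendsto_atTop_ciInf hanti ⟨0, by rintro _ ⟨k, rfl⟩; exact hV k⟩
  have hdiff := hlim.sub ((tendsto_add_atTop_iff_nat 1).2 hlim)
  rw [sub_self] at hdiff
  exact squeeze_zero ha (fun k => by linarith [h k]) hdiff

end MeanSquare

/-! ### Components of the closed loop along Laplacian eigenvectors -/

namespace LoopState

variable {N n m d : ℕ} (A : Matrix (Fin n) (Fin n) ℝ) (B : Matrix (Fin n) (Fin m) ℝ) (p : ℝ)

/-- The component of the agents' states along the vector `v` of weights. -/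
def modeState (v : Fin N → ℝ) (s : LoopState N n m d) : Fin n → ℝ := ∑ i, v i • s.x i

/-- The component along `v` of the inputs applied `j + 1` steps ago. -/
def modePast (v : Fin N → ℝ) (s : LoopState N n m d) (j : Fin d) : Fin m → ℝ :=
  ∑ i, v i • s.past j i

/-- The component along `v` of the predictors. -/
def modePredictor (v : Fin N → ℝ) (s : LoopState N n m d) : Fin n → ℝ :=
  ∑ i, v i • s.predictor A B p i

theorem modePredictor_eq (v : Fin N → ℝ) (s : LoopState N n m d) :
    s.modePredictor A B p v = (A ^ d) *ᵥ s.modeState v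
      + (1 - p) • ∑ j : Fin d, (A ^ (j : ℕ) * B) *ᵥ s.modePast v j := by
  simp only [modePredictor, modeState, modePast, predictor, mulVec_sum, mulVec_smul, smul_add,
    Finset.sum_add_distrib, Finset.smul_sum]
  congr 1
  rw [Finset.sum_comm]
  exact Finset.sum_congr rfl fun j _ => Finset.sum_congr rfl fun i _ => smul_comm _ _ _

/-- Along a Laplacian eigenvector the protocol is a feedback of the predictor component. -/
theorem sum_smul_protocol (G : WeightedGraph N) (K : Matrix (Fin m) (Fin n) ℝ)
    {v : Fin N → ℝ} {l : ℝ} (hv : G.laplacian *ᵥ v = l • v) (s : LoopState N n m d) :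
    ∑ i, v i • s.protocol A B p G K i = (-l) • K *ᵥ s.modePredictor A B p v := by
  have hl : ∀ r, l * v r = ∑ i, G.weight r i * (v r - v i) := fun r => by
    rw [← G.laplacian_mulVec_apply, hv]
    rfl
  simp only [protocol, ← mulVec_smul, ← mulVec_sum]
  congr 1
  ext c
  simp only [modePredictor, Finset.sum_apply, Pi.smul_apply, Pi.sub_apply, smul_eq_mul,
    Finset.mul_sum]
  have e1 : ∀ r, -l * (v r * s.predictor A B p r c)
      = ∑ i, G.weight r i * (v i - v r) * s.predictor A B p r c := by
    intro r
    rw [← mul_assoc, neg_mul, hl, ← Finset.sum_neg_distrib, Finset.sum_mul]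
    exact Finset.sum_congr rfl fun i _ => by ring
  have e2 : ∀ r, (∑ i, G.weight r i * (v i - v r) * s.predictor A B p r c)
      = ∑ i, G.weight i r * v i * s.predictor A B p r c
        - ∑ i, G.weight r i * v r * s.predictor A B p r c := by
    intro r
    rw [← Finset.sum_sub_distrib]
    exact Finset.sum_congr rfl fun i _ => by rw [G.weight_comm i r]; ring
  simp only [e1, e2, Finset.sum_sub_distrib]
  simp only [mul_sub, Finset.sum_sub_distrib]
  rw [Finset.sum_comm (f := fun r i => G.weight i r * v i * s.predictor A B p r c)]
  congr 1 <;> exact Finset.sum_congr rfl fun i _ => Finset.sum_congr rfl fun j _ => by ring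

/-- The component along `v` of the inputs, the present one included. -/
def modeInputs (G : WeightedGraph N) (K : Matrix (Fin m) (Fin n) ℝ) (v : Fin N → ℝ)
    (s : LoopState N n m d) (j : Fin (d + 1)) : Fin m → ℝ :=
  ∑ i, v i • s.inputs A B p G K j i

theorem modeInputs_succ (G : WeightedGraph N) (K : Matrix (Fin m) (Fin n) ℝ) (v : Fin N → ℝ)
    (s : LoopState N n m d) (j : Fin d) :
    s.modeInputs A B p G K v j.succ = s.modePast v j := by
  simp [modeInputs, modePast, inputs]

theorem modeInputs_zero (G : WeightedGraph N) (K : Matrix (Fin m) (Fin n) ℝ) {v : Fin N → ℝ}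
    {l : ℝ} (hv : G.laplacian *ᵥ v = l • v) (s : LoopState N n m d) :
    s.modeInputs A B p G K v 0 = (-l) • K *ᵥ s.modePredictor A B p v := by
  rw [← sum_smul_protocol A B p G K hv]
  simp [modeInputs, inputs]

end LoopState

section ClosedLoop

open LoopState

variable {N n m d : ℕ} {A : Matrix (Fin n) (Fin n) ℝ} {B : Matrix (Fin n) (Fin m) ℝ} {p : ℝ}
  {G : WeightedGraph N} {K : Matrix (Fin m) (Fin n) ℝ} {x₀ : Fin N → Fin n → ℝ}
  {u₀ : Fin d → Fin N → Fin m → ℝ}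

theorem modePast_closedLoop_succ (g : ℕ → ℝ) (v : Fin N → ℝ) (k : ℕ) (j : Fin d) :
    (closedLoop A B p G K g x₀ u₀ (k + 1)).modePast v j
      = (closedLoop A B p G K g x₀ u₀ k).modeInputs A B p G K v j.castSucc := rfl

theorem modeState_closedLoop_succ (g : ℕ → ℝ) (v : Fin N → ℝ) (k : ℕ) :
    (closedLoop A B p G K g x₀ u₀ (k + 1)).modeState v
      = A *ᵥ (closedLoop A B p G K g x₀ u₀ k).modeState v
        + g k • B *ᵥ (closedLoop A B p G K g x₀ u₀ k).modeInputs A B p G K v (Fin.last d) := by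
  simp only [closedLoop, modeState, modeInputs, mulVec_sum, mulVec_smul, smul_add,
    Finset.sum_add_distrib, Finset.smul_sum]
  congr 1
  exact Finset.sum_congr rfl fun i _ => smul_comm _ _ _

/-- The predictor turns the delayed loop into one without delay in the drift: the delayed input
enters only through the centered packet noise. -/
theorem modePredictor_closedLoop_succ (g : ℕ → ℝ) (v : Fin N → ℝ) (k : ℕ) :
    (closedLoop A B p G K g x₀ u₀ (k + 1)).modePredictor A B p v
      = A *ᵥ (closedLoop A B p G K g x₀ u₀ k).modePredictor A B p v
        + (1 - p) • B *ᵥ (closedLoop A B p G K g x₀ u₀ k).modeInputs A B p G K v 0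
        + (g k - (1 - p)) • (A ^ d * B) *ᵥ
          (closedLoop A B p G K g x₀ u₀ k).modeInputs A B p G K v (Fin.last d) := by
  rw [modePredictor_eq, modePredictor_eq, modeState_closedLoop_succ]
  simp only [modePast_closedLoop_succ]
  set s := closedLoop A B p G K g x₀ u₀ k
  set w := s.modeInputs A B p G K v
  have hsum : ∑ j : Fin d, (A ^ (j : ℕ) * B) *ᵥ w j.castSucc + (A ^ d * B) *ᵥ w (Fin.last d)
      = B *ᵥ w 0 + A *ᵥ ∑ j : Fin d, (A ^ (j : ℕ) * B) *ᵥ s.modePast v j := by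
    have h := Fin.sum_univ_castSucc fun j : Fin (d + 1) => (A ^ (j : ℕ) * B) *ᵥ w j
    rw [Fin.sum_univ_succ] at h
    simp only [Fin.val_castSucc, Fin.val_last] at h
    rw [← h, mulVec_sum]
    simp [w, modeInputs_succ, pow_succ', mulVec_mulVec, Matrix.mul_assoc]
  have hsum' := eq_sub_of_add_eq hsum
  rw [hsum', mulVec_add, mulVec_add, mulVec_smul, mulVec_smul, mulVec_mulVec, mulVec_mulVec,
    mulVec_mulVec, ← pow_succ, ← pow_succ']
  module

variable {Ω : Type*} [MeasurableSpace Ω] {Pr : Measure Ω} [IsProbabilityMeasure Pr]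
  {g : ℕ → Ω → ℝ}

theorem adapted_closedLoop {s2 : ℝ} (hξ : IsCenteredNoise Pr s2 fun k ω => g k ω - (1 - p))
    (k : ℕ) :
    (∀ i, EntriesIn (adaptedL2 Pr (fun k ω => g k ω - (1 - p)) k) fun ω =>
      (closedLoop A B p G K (fun t => g t ω) x₀ u₀ k).x i) ∧
    ∀ j i, EntriesIn (adaptedL2 Pr (fun k ω => g k ω - (1 - p)) k) fun ω =>
      (closedLoop A B p G K (fun t => g t ω) x₀ u₀ k).past j i := by
  induction k with
  | zero => exact ⟨fun i => EntriesIn.const 0 _, fun j i => EntriesIn.const 0 _⟩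
  | succ k ih =>
    obtain ⟨hx, hu⟩ := ih
    have hz : ∀ i, EntriesIn (adaptedL2 Pr (fun k ω => g k ω - (1 - p)) k) fun ω =>
        (closedLoop A B p G K (fun t => g t ω) x₀ u₀ k).predictor A B p i := fun i =>
      ((hx i).mulVec _).add ((EntriesIn.sum fun j => (hu j i).mulVec _).smul _)
    have hin : ∀ j i, EntriesIn (adaptedL2 Pr (fun k ω => g k ω - (1 - p)) k) fun ω =>
        (closedLoop A B p G K (fun t => g t ω) x₀ u₀ k).inputs A B p G K j i := by
      intro j i
      refine Fin.cases ?_ (fun j => hu j i) j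
      exact (EntriesIn.sum fun r => ((hz r).sub (hz i)).smul _).mulVec K
    refine ⟨fun i => ?_, fun j i => (hin j.castSucc i).succ⟩
    have h := (((hx i).mulVec A).succ.add (((hin (Fin.last d) i).mulVec B).smul (1 - p)).succ).add
      (((hin (Fin.last d) i).mulVec B).noise_smul hξ)
    convert h using 2 with ω
    simp only [closedLoop]
    module

/-- Consensus in one mode: under the Lyapunov inequality the component of the agents' states along
a Laplacian eigenvector tends to zero in mean square. The Lyapunov function is the second moment
`E z'Pz` of the predictor component plus `σ²` times the moments `E ‖A^d B u‖²_P` of the inputs that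
are still on their way. -/
theorem entriesIn_msNull_modeState (hp : p ∈ Set.Ioo (0 : ℝ) 1) (hg : IsPacketProcess Pr p g)
    (hA : IsUnit A.det) {P Q : Matrix (Fin n) (Fin n) ℝ} (hP : P.PosSemidef) (hQ : Q.PosDef)
    {v : Fin N → ℝ} {l : ℝ} (hv : G.laplacian *ᵥ v = l • v)
    (hlyap : ∀ z, quad P (A *ᵥ z + (1 - p) • B *ᵥ (-l) • K *ᵥ z)
      + p * (1 - p) * quad P ((A ^ d * B) *ᵥ (-l) • K *ᵥ z) ≤ quad P z - quad Q z) :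
    EntriesIn (msNull Pr) fun y : ℕ × Ω =>
      (closedLoop A B p G K (fun t => g t y.2) x₀ u₀ y.1).modeState v := by
  have hξ := hg.isCenteredNoise hp
  set ξ : ℕ → Ω → ℝ := fun k ω => g k ω - (1 - p) with hξdef
  set s : ℕ → Ω → LoopState N n m d := fun k ω => closedLoop A B p G K (fun t => g t ω) x₀ u₀ k
    with hs
  have hσ : 0 ≤ p * (1 - p) := mul_nonneg hp.1.le (by linarith [hp.2])
  have hx : ∀ k, EntriesIn (adaptedL2 Pr ξ k) fun ω => (s k ω).modeState v := fun k =>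
    EntriesIn.sum fun i => ((adapted_closedLoop hξ k).1 i).smul _
  have hu : ∀ k j, EntriesIn (adaptedL2 Pr ξ k) fun ω => (s k ω).modePast v j := fun k j =>
    EntriesIn.sum fun i => ((adapted_closedLoop hξ k).2 j i).smul _
  have hz : ∀ k, EntriesIn (adaptedL2 Pr ξ k) fun ω => (s k ω).modePredictor A B p v := by
    intro k
    simp only [modePredictor_eq]
    exact ((hx k).mulVec _).add ((EntriesIn.sum fun j => (hu k j).mulVec _).smul _)
  have hw : ∀ k j, EntriesIn (adaptedL2 Pr ξ k) fun ω => (s k ω).modeInputs A B p G K v j := by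
    intro k j
    refine Fin.cases ?_ (fun j => ?_) j
    · simp only [modeInputs_zero A B p G K hv]
      exact ((hz k).mulVec K).smul _
    · simp only [modeInputs_succ]
      exact hu k j
  set V : ℕ → ℝ := fun k => ∫ ω, quad P ((s k ω).modePredictor A B p v) ∂Pr
    + p * (1 - p) * ∑ j, ∫ ω, quad P ((A ^ d * B) *ᵥ (s k ω).modePast v j) ∂Pr with hV
  have hV0 : ∀ k, 0 ≤ V k := fun k =>
    add_nonneg (integral_nonneg fun ω => quad_nonneg hP _) (mul_nonneg hσ
      (Finset.sum_nonneg fun j _ => integral_nonneg fun ω => quad_nonneg hP _))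
  have hstep : ∀ k, V (k + 1) + ∫ ω, quad Q ((s k ω).modePredictor A B p v) ∂Pr ≤ V k := by
    intro k
    have hzs : ∀ ω, (s (k + 1) ω).modePredictor A B p v
        = (A *ᵥ (s k ω).modePredictor A B p v
          + (1 - p) • B *ᵥ (s k ω).modeInputs A B p G K v 0)
          + ξ k ω • (A ^ d * B) *ᵥ (s k ω).modeInputs A B p G K v (Fin.last d) := fun ω =>
      modePredictor_closedLoop_succ _ v k
    have hf := ((hz k).mulVec A).add (((hw k 0).mulVec B).smul (1 - p))
    have hm : ∫ ω, quad P ((s (k + 1) ω).modePredictor A B p v) ∂Pr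
        = ∫ ω, quad P (A *ᵥ (s k ω).modePredictor A B p v
            + (1 - p) • B *ᵥ (s k ω).modeInputs A B p G K v 0) ∂Pr
          + p * (1 - p) * ∫ ω, quad P ((A ^ d * B) *ᵥ
            (s k ω).modeInputs A B p G K v (Fin.last d)) ∂Pr := by
      simp only [hzs]
      exact hf.integral_quad_add_noise_smul hξ ((hw k (Fin.last d)).mulVec _) P
    -- the inputs on their way move up by one slot
    have hshift : ∑ j, ∫ ω, quad P ((A ^ d * B) *ᵥ (s (k + 1) ω).modePast v j) ∂Pr
        + ∫ ω, quad P ((A ^ d * B) *ᵥ (s k ω).modeInputs A B p G K v (Fin.last d)) ∂Pr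
        = ∫ ω, quad P ((A ^ d * B) *ᵥ (s k ω).modeInputs A B p G K v 0) ∂Pr
        + ∑ j, ∫ ω, quad P ((A ^ d * B) *ᵥ (s k ω).modePast v j) ∂Pr := by
      have h := Fin.sum_univ_castSucc fun j : Fin (d + 1) =>
        ∫ ω, quad P ((A ^ d * B) *ᵥ (s k ω).modeInputs A B p G K v j) ∂Pr
      rw [Fin.sum_univ_succ] at h
      simp only [modeInputs_succ] at h
      exact h.symm
    have hint : ∫ ω, quad P (A *ᵥ (s k ω).modePredictor A B p v
          + (1 - p) • B *ᵥ (s k ω).modeInputs A B p G K v 0) ∂Pr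
        + p * (1 - p) * ∫ ω, quad P ((A ^ d * B) *ᵥ (s k ω).modeInputs A B p G K v 0) ∂Pr
        ≤ ∫ ω, quad P ((s k ω).modePredictor A B p v) ∂Pr
          - ∫ ω, quad Q ((s k ω).modePredictor A B p v) ∂Pr := by
      have i1 := hf.integrable_quad P
      have i2 := (((hw k 0).mulVec (A ^ d * B)).integrable_quad P).const_mul (p * (1 - p))
      have i3 := (hz k).integrable_quad P
      have i4 := (hz k).integrable_quad Q
      rw [← integral_const_mul, ← integral_add i1 i2, ← integral_sub i3 i4]
      refine integral_mono (i1.add i2) (i3.sub i4) fun ω => ?_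
      simp only [modeInputs_zero A B p G K hv]
      exact hlyap _
    simp only [hV, hm]
    have := congrArg (fun t => p * (1 - p) * t) hshift
    simp only [mul_add] at this
    linarith
  have hzn : EntriesIn (msNull Pr) fun y : ℕ × Ω => (s y.1 y.2).modePredictor A B p v :=
    entriesIn_msNull_of_tendsto_quad hQ hz (tendsto_zero_of_lyapunov hV0
      (fun k => integral_nonneg fun ω => quad_nonneg hQ.posSemidef _) hstep)
  have hun : ∀ j (hj : j < d),
      EntriesIn (msNull Pr) fun y : ℕ × Ω => (s y.1 y.2).modePast v ⟨j, hj⟩ := by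
    intro j
    induction j with
    | zero =>
      intro hj c
      refine mem_msNull_of_shift (fun k => (mem_adaptedL2.1 (hu k ⟨0, hj⟩ c)).2) ?_
      have h := ((hzn.mulVec K).smul (-l)) c
      simp only [← modeInputs_zero A B p G K hv] at h
      exact h
    | succ j ih =>
      intro hj c
      refine mem_msNull_of_shift (fun k => (mem_adaptedL2.1 (hu k ⟨j + 1, hj⟩ c)).2) ?_
      have h := ih (by omega) c
      simp only [← modeInputs_succ A B p G K] at h
      exact h
  have hxn := (hzn.sub ((EntriesIn.sum fun j : Fin d =>
    (hun j j.2).mulVec (A ^ (j : ℕ) * B)).smul (1 - p))).mulVec (A ^ d)⁻¹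
  convert hxn using 2 with y
  have hAd : IsUnit (A ^ d).det := by rw [det_pow]; exact hA.pow d
  rw [modePredictor_eq, add_sub_cancel_right, mulVec_mulVec, nonsing_inv_mul _ hAd, one_mulVec]

/-- The gain built from a solution of the PARE enforces consensus: a difference of two agents'
states has no component along a constant eigenvector. -/
theorem enforcesConsensus_consensusGain {hN : 2 ≤ N} (hp : p ∈ Set.Ioo (0 : ℝ) 1)
    (hg : IsPacketProcess Pr p g) (hA : IsUnit A.det) (hB : B.rank = m)
    {Q P : Matrix (Fin n) (Fin n) ℝ} (hQ : Q.PosDef) {R : Matrix (Fin m) (Fin m) ℝ}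
    (hR : R.PosDef) (hpos : 0 < gammaTwo p G hN)
    (hP : IsPareSolution d A B Q R (gammaTwo p G hN) P) (x₀ : Fin N → Fin n → ℝ)
    (u₀ : Fin d → Fin N → Fin m → ℝ) :
    EnforcesConsensus Pr g A B p G (consensusGain d A B p G hN P) x₀ u₀ := by
  have h2 := lamTwo_pos_of_gammaTwo_pos hpos
  obtain ⟨v, lam, heig, hres, hdich⟩ := G.exists_eigenbasis hN h2
  intro i j
  set s : ℕ × Ω → LoopState N n m d := fun y =>
    closedLoop A B p G (consensusGain d A B p G hN P) (fun t => g t y.2) x₀ u₀ y.1 with hs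
  have hx : ∀ y r, (s y).x r = ∑ l, v l r • (s y).modeState (v l) := by
    intro y r
    simp only [modeState, Finset.smul_sum, smul_smul]
    rw [Finset.sum_comm]
    simp only [← Finset.sum_smul, hres]
    simp
  have hmode : ∀ l, EntriesIn (msNull Pr) fun y =>
      (v l j - v l i) • (s y).modeState (v l) := by
    intro l
    rcases hdich l with hc | hl
    · simp only [hc j i, sub_self, zero_smul]
      exact fun c => (msNull Pr).zero_mem
    · exact (entriesIn_msNull_modeState hp hg hA hP.1.posSemidef hQ (heig l)
        (lyapunov_inequality hB hp hR h2 hP hl)).smul _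
  have hsum : EntriesIn (msNull Pr) fun y => (s y).x j - (s y).x i := by
    simp only [hx, ← Finset.sum_sub_distrib, ← sub_smul]
    exact EntriesIn.sum hmode
  exact hsum.tendsto_integral_sqNorm

end ClosedLoop

theorem theorem3 {Ω : Type*} [MeasurableSpace Ω] (Pr : Measure Ω) [IsProbabilityMeasure Pr]
    {Ω' : Type*} [MeasurableSpace Ω'] (Pr' : Measure Ω') [IsProbabilityMeasure Pr']
    {N n m : ℕ} (hN : 2 ≤ N) (d : ℕ)
    (A : Matrix (Fin n) (Fin n) ℝ) (B : Matrix (Fin n) (Fin m) ℝ)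
    (G : WeightedGraph N) (p : ℝ) (hp : p ∈ Set.Ioo (0 : ℝ) 1)
    -- the packet process
    (g : ℕ → Ω → ℝ) (hg : IsPacketProcess Pr p g)
    -- all eigenvalues of `A` are on or outside the unit circle, `B` has full column rank
    (hA : ∀ z ∈ spectrum ℂ (A.map (algebraMap ℝ ℂ)), 1 ≤ ‖z‖)
    (hB : B.rank = m)
    -- `(A, B, 0, A^d B)` is mean-square stabilizable
    (ν : ℕ → Ω' → ℝ) (hν : IsWhiteNoise Pr' ν)
    (hstab : MeanSquareStabilizable Pr' ν A B 0 (A ^ d * B))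
    (hconn : G.toSimpleGraph.Connected)
    -- the weights of the PARE
    (Q : Matrix (Fin n) (Fin n) ℝ) (hQ : Q.PosDef)
    (R : Matrix (Fin m) (Fin m) ℝ) (hR : R.PosDef)
    (hcrit : criticalValue d A B Q R < gammaTwo p G hN) :
    MeanSquareConsensusable Pr g d A B p G ∧
    (∃ P, IsPareSolution d A B Q R (gammaTwo p G hN) P) ∧
    ∀ P, IsPareSolution d A B Q R (gammaTwo p G hN) P →
      ∀ (x₀ : Fin N → Fin n → ℝ) (u₀ : Fin d → Fin N → Fin m → ℝ),
        EnforcesConsensus Pr g A B p G (consensusGain d A B p G hN P) x₀ u₀ := by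
  have hdet := isUnit_det_of_one_le_spectrum hA
  have hpos : 0 < gammaTwo p G hN := criticalValue_nonneg.trans_lt hcrit
  obtain ⟨K, hK⟩ := hstab.exists_tendsto_quad hν
  obtain ⟨P, hP⟩ := exists_isPareSolution_of_criticalValue_lt hQ hR
    (exists_isPareSolution_one hQ hR K hK) hcrit (gammaTwo_le_one G hN hp)
  have hcons : ∀ P, IsPareSolution d A B Q R (gammaTwo p G hN) P →
      ∀ (x₀ : Fin N → Fin n → ℝ) (u₀ : Fin d → Fin N → Fin m → ℝ),
        EnforcesConsensus Pr g A B p G (consensusGain d A B p G hN P) x₀ u₀ :=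
    fun P hP => enforcesConsensus_consensusGain hp hg hdet hB hQ hR hpos hP
  exact ⟨fun x₀ u₀ => ⟨_, hcons P hP x₀ u₀⟩, ⟨P, hP⟩, hcons⟩
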